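/- Let $d\in\mathbb N$, $\beta>0$, and let $\rho,h:\mathbb R^d\to\mathbb R$ satisfy: (A1) $\rho=e^{-V}$ is a probability density with $\int|x|^2\rho\,dx<\infty$, where $V\in C^2$, $D^2V$ is bounded, and $\liminf_{|x|\to\infty}\nabla V(x)\cdot\frac{x}{|x|}=\infty$; (A2) $h\in C^2$, $\int h^2\rho\,dx<\infty$, $D^2h$ is bounded, and $\liminf_{|x|\to\infty}\nabla h(x)\cdot\frac{x}{|x|}>-\infty$. Write $\hat h=\int h\rho\,dx$ and $\|w\|_2^2=\int|w|^2\rho\,dx\in[0,\infty]$ for vector fields $w$. Let $H^1(\mathbb R^d;\rho)$ be the space of $\psi$ with $\int\psi^2\rho\,dx<\infty$ whose weak gradient satisfies $\|\nabla\psi\|_2<\infty$. A weak solution of the Poisson equation $-\nabla\cdot(\rho\nabla\phi)=(h-\hat h)\rho$, $\int\phi\rho\,dx=0$, is a function $\phi\in H^1(\mathbb R^d;\rho)$ with $\int\phi\rho\,dx=0$ and $\int\nabla\phi\cdot\nabla\psi\,\rho\,dx=\int(h-\hat h)\psi\rho\,dx$ for all $\psi\in H^1(\mathbb R^d;\rho)$.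 For a locally integrable vector field $u$ and a locally integrable function $f$, the equation $\frac1\rho\nabla\cdot(\rho u)=f$ is understood in the sense of distributions: $\int u\cdot\nabla\psi\,\rho\,dx=-\int f\psi\rho\,dx$ for all $\psi\in C_c^\infty(\mathbb R^d)$; the equation $\nabla\cdot(\rho v)=0$ is the case $f=0$. Then the Poisson equation has a weak solution $\phi$, and $\phi$ and $\nabla\phi$ are unique up to equality almost everywhere. A locally integrable vector field $u$ solves $$\frac1\rho\nabla\cdot(\rho u)=\beta(h-\hat h)\qquad(\ast)$$ if and only if $u=-\beta\nabla\phi+v$ almost everywhere for some locally integrable $v$ with $\nabla\cdot(\rho v)=0$. For all such $u,v$, $$\|u\|_2^2=\beta^2\|\nabla\phi\|_2^2+\|v\|_2^2 ,$$ both sides being possibly $+\infty$. In particular $-\beta\nabla\phi$ solves $(\ast)$, has finite norm, and is the minimum-norm solution: every solution $u$ of $(\ast)$ satisfies $\|\beta\nabla\phi\|_2\le\|u\|_2$, with equality only if $u=-\beta\nabla\phi$ almost everywhere. -/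

import Mathlib

open MeasureTheory Filter Topology
open scoped ENNReal ContDiff

noncomputable section

namespace L2Opt

/-- `ℝ^d` with its Euclidean norm and inner product. -/
abbrev E (d : ℕ) := EuclideanSpace ℝ (Fin d)

/-- The measure `ρ(x) dx`. -/
def wMeasure {d : ℕ} (ρ : E d → ℝ) : Measure (E d) :=
  volume.withDensity fun x => ENNReal.ofReal (ρ x)

/-- Probability densities on `ℝ^d` with finite second moment. -/
structure IsDensity {d : ℕ} (ρ : E d → ℝ) : Prop where
  measurable : Measurable ρ
  nonneg : ∀ x, 0 ≤ ρ x
  integrable : Integrable ρ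
  integral_eq_one : ∫ x, ρ x = 1
  second_moment : Integrable fun x => ‖x‖ ^ 2 * ρ x

/-- The radial derivative `∇f(x) · x / |x|`, as an extended real number. -/
def radialDeriv {d : ℕ} (f : E d → ℝ) (x : E d) : EReal :=
  ((inner ℝ (gradient f x) (‖x‖⁻¹ • x) : ℝ) : EReal)

/-- `f ∈ C²` with bounded Hessian. -/
def IsC2BoundedHessian {d : ℕ} (f : E d → ℝ) : Prop :=
  ContDiff ℝ 2 f ∧ ∃ C : ℝ, ∀ x, ‖fderiv ℝ (fderiv ℝ f) x‖ ≤ C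

/-- Assumption on the density: `ρ = e^{-V}` is a probability density with finite second moment,
`V ∈ C²`, `D²V ∈ L^∞` and `liminf_{|x| → ∞} ∇V(x) · x/|x| = ∞`. -/
def AssumptionA1 {d : ℕ} (ρ : E d → ℝ) : Prop :=
  IsDensity ρ ∧ ∃ V : E d → ℝ, (∀ x, ρ x = Real.exp (-V x)) ∧ IsC2BoundedHessian V ∧
    liminf (radialDeriv V) (Bornology.cobounded (E d)) = ⊤

/-- Assumption on the objective function: `h ∈ C² ∩ L²(ρ)`, `D²h ∈ L^∞` and
`liminf_{|x| → ∞} ∇h(x) · x/|x| > -∞`. -/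
def AssumptionA2 {d : ℕ} (ρ h : E d → ℝ) : Prop :=
  IsC2BoundedHessian h ∧ MemLp h 2 (wMeasure ρ) ∧
    ⊥ < liminf (radialDeriv h) (Bornology.cobounded (E d))

/-- The mean `∫ f ρ dx`. -/
def mean {d : ℕ} (ρ f : E d → ℝ) : ℝ := ∫ x, f x ∂(wMeasure ρ)

/-- Test functions: `C_c^∞(ℝ^d)`. -/
def IsTest {d : ℕ} (ψ : E d → ℝ) : Prop := ContDiff ℝ ∞ ψ ∧ HasCompactSupport ψ

/-- `G` is the weak (distributional) gradient of `φ` on `ℝ^d`. -/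
structure HasWeakGradient {d : ℕ} (φ : E d → ℝ) (G : E d → E d) : Prop where
  locallyIntegrable : LocallyIntegrable φ
  locallyIntegrable_grad : LocallyIntegrable G
  integral_eq : ∀ ψ : E d → ℝ, IsTest ψ → ∀ e : E d,
    ∫ x, φ x * fderiv ℝ ψ x e = -∫ x, inner ℝ (G x) e * ψ x

/-- `φ ∈ H¹(ℝ^d; ρ)`, with weak gradient `∇φ = G`. -/
structure InH1 {d : ℕ} (ρ : E d → ℝ) (φ : E d → ℝ) (G : E d → E d) : Prop where
  memLp : MemLp φ 2 (wMeasure ρ)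
  hasWeakGradient : HasWeakGradient φ G
  memLp_grad : MemLp G 2 (wMeasure ρ)

/-- `φ ∈ H¹_0(ℝ^d; ρ)` (zero mean), with weak gradient `G`, is a weak solution of
`-∇·(ρ∇φ) = (h - ĥ) ρ`, `∫ φ ρ dx = 0`. -/
structure IsPoissonSolution {d : ℕ} (ρ h : E d → ℝ) (φ : E d → ℝ) (G : E d → E d) : Prop where
  inH1 : InH1 ρ φ G
  mean_zero : mean ρ φ = 0
  weak_eq : ∀ (ψ : E d → ℝ) (Ψ : E d → E d), InH1 ρ ψ Ψ →
    ∫ x, inner ℝ (G x) (Ψ x) ∂(wMeasure ρ) = ∫ x, (h x - mean ρ h) * ψ x ∂(wMeasure ρ)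

/-- The vector field `u` solves `(1/ρ) ∇·(ρ u) = f` on `ℝ^d` in the sense of distributions. -/
structure SolvesDiv {d : ℕ} (ρ f : E d → ℝ) (u : E d → E d) : Prop where
  locallyIntegrable : LocallyIntegrable u (wMeasure ρ)
  locallyIntegrable_rhs : LocallyIntegrable f (wMeasure ρ)
  weak_eq : ∀ ψ : E d → ℝ, IsTest ψ →
    ∫ x, inner ℝ (u x) (gradient ψ x) ∂(wMeasure ρ) = -∫ x, f x * ψ x ∂(wMeasure ρ)

/-- `∇·(ρ v) = 0` in the sense of distributions. -/
def DivFree {d : ℕ} (ρ : E d → ℝ) (v : E d → E d) : Prop := SolvesDiv ρ (fun _ => 0) v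

/-- `u` solves the control equation `(1/ρ) ∇·(ρ u) = β (h - ĥ)`. -/
def SolvesControl {d : ℕ} (ρ h : E d → ℝ) (β : ℝ) (u : E d → E d) : Prop :=
  SolvesDiv ρ (fun x => β * (h x - mean ρ h)) u

/-- The squared norm `‖u‖₂² = ∫ |u|² ρ dx` of a vector field, with values in `[0, ∞]`. -/
def normSq {d : ℕ} (ρ : E d → ℝ) (u : E d → E d) : ℝ≥0∞ := ∫⁻ x, ‖u x‖ₑ ^ 2 ∂(wMeasure ρ)

end L2Opt

end

namespace L2Opt

variable {d : ℕ} {ρ : E d → ℝ}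

/-! Everything rests on two facts about `H¹(ρ)`. The first is density of test functions
(`InH1.exists_test`): cut off at a large radius, then mollify; on compact sets `ρ` is bounded above
and below, so the unweighted theory applies. The second is a Poincaré inequality
(`AssumptionA1.exists_poincare`), proved by a Lyapunov argument. Integrating the divergence of `ρ f²
x/√(1+|x|²)` and using that the radial derivative of `V` tends to infinity bounds `∫ f² ρ` by `∫
|∇f|² ρ` plus the integral of `f² ρ` over a ball, and on that ball the classical Poincaré inequality
holds.

Existence is then Lax–Milgram on `H¹(ρ)`, realised as a closed subspace of `L²(ρ) × L²(ρ; ℝ^d)`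
(`exists_weak_solution`). Uniqueness follows by testing the difference of two solutions against
itself and applying Poincaré.

The control equation is linear and `-β∇φ` solves it, so its solutions are the translates of `-β∇φ`
by divergence-free fields. By density, `∇φ` is orthogonal to every divergence-free field in `L²(ρ)`,
not only when paired through test functions. The norm identity is Pythagoras, with both sides
infinite when `v` is not square integrable, and minimality can be read off from it. -/

/-! ### Comparison of `ρ dx` with Lebesgue measure. -/

theorem wMeasure_absolutelyContinuous (ρ : E d → ℝ) : wMeasure ρ ≪ volume :=
  withDensity_absolutelyContinuous _ _

theorem volume_absolutelyContinuous_wMeasure (hρ : Continuous ρ) (hpos : ∀ x, 0 < ρ x) :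
    (volume : Measure (E d)) ≪ wMeasure ρ := by
  refine withDensity_absolutelyContinuous' (by fun_prop) ?_
  exact Eventually.of_forall fun x => by simpa using hpos x

theorem integral_wMeasure {F : Type*} [NormedAddCommGroup F] [NormedSpace ℝ F]
    (hρ : Continuous ρ) (hpos : ∀ x, 0 < ρ x) (f : E d → F) :
    ∫ x, f x ∂(wMeasure ρ) = ∫ x, ρ x • f x := by
  rw [wMeasure, integral_withDensity_eq_integral_toReal_smul (by fun_prop) (by simp)]
  simp_rw [ENNReal.toReal_ofReal (hpos _).le]

theorem IsDensity.isProbabilityMeasure (h : IsDensity ρ) : IsProbabilityMeasure (wMeasure ρ) := by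
  constructor
  rw [wMeasure, withDensity_apply _ MeasurableSet.univ, setLIntegral_univ,
    ← ofReal_integral_eq_lintegral_ofReal h.integrable (Eventually.of_forall h.nonneg),
    h.integral_eq_one, ENNReal.ofReal_one]

/-- A positive continuous `ρ` has a positive minimum `m` on a compact set, and `c = 1/m` works. -/
theorem exists_volume_restrict_le (hρ : Continuous ρ) (hpos : ∀ x, 0 < ρ x) {K : Set (E d)}
    (hK : IsCompact K) :
    ∃ c : ℝ≥0∞, c ≠ 0 ∧ c ≠ ⊤ ∧ volume.restrict K ≤ c • wMeasure ρ := by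
  obtain ⟨m, hm, hmK⟩ : ∃ m : ℝ, 0 < m ∧ ∀ x ∈ K, m ≤ ρ x := by
    rcases K.eq_empty_or_nonempty with rfl | hne
    · exact ⟨1, one_pos, by simp⟩
    · obtain ⟨x, -, hx⟩ := hK.exists_isMinOn hne hρ.continuousOn
      exact ⟨ρ x, hpos x, fun y hy => hx hy⟩
  have hm0 : ENNReal.ofReal m ≠ 0 := by simpa using hm
  refine ⟨(ENNReal.ofReal m)⁻¹, by simp, by simpa using hm, ?_⟩
  refine Measure.le_iff.2 fun s hs => ?_
  rw [Measure.smul_apply, smul_eq_mul, wMeasure, withDensity_apply _ hs, Measure.restrict_apply hs,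
    ← ENNReal.mul_le_iff_le_inv hm0 (by simp), ← setLIntegral_const]
  calc ∫⁻ _ in s ∩ K, ENNReal.ofReal m ≤ ∫⁻ x in s ∩ K, ENNReal.ofReal (ρ x) :=
        setLIntegral_mono (by fun_prop) fun x hx => ENNReal.ofReal_le_ofReal (hmK x hx.2)
    _ ≤ _ := lintegral_mono_set Set.inter_subset_left

theorem exists_wMeasure_restrict_le (hρ : Continuous ρ) {K : Set (E d)} (hK : IsCompact K) :
    ∃ c : ℝ≥0∞, c ≠ 0 ∧ c ≠ ⊤ ∧ (wMeasure ρ).restrict K ≤ c • volume.restrict K := by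
  obtain ⟨M, hM⟩ := hK.exists_bound_of_continuousOn hρ.continuousOn
  refine ⟨ENNReal.ofReal (max M 1), by simp, by simp, ?_⟩
  refine Measure.le_iff.2 fun s hs => ?_
  rw [Measure.smul_apply, smul_eq_mul, wMeasure, Measure.restrict_apply hs,
    Measure.restrict_apply hs, withDensity_apply' _ (s ∩ K), ← setLIntegral_const]
  refine setLIntegral_mono (by fun_prop) fun x hx => ENNReal.ofReal_le_ofReal ?_
  exact (le_abs_self _).trans ((hM x hx.2).trans (le_max_left _ _))

theorem eLpNorm_restrict_le_of_measure_le {F : Type*} [NormedAddCommGroup F]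
    {μ ν : Measure (E d)} {c : ℝ≥0∞} (hc : c ≠ 0) (h : μ ≤ c • ν) (f : E d → F) :
    eLpNorm f 2 μ ≤ c ^ (1 / 2 : ℝ) * eLpNorm f 2 ν := by
  refine (eLpNorm_mono_measure f h).trans ?_
  rw [eLpNorm_smul_measure_of_ne_zero hc]
  simp

theorem memLp_restrict_of_wMeasure {F : Type*} [NormedAddCommGroup F]
    (hρ : Continuous ρ) (hpos : ∀ x, 0 < ρ x) {f : E d → F} (hf : MemLp f 2 (wMeasure ρ))
    {K : Set (E d)} (hK : IsCompact K) : MemLp f 2 (volume.restrict K) := by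
  obtain ⟨c, hc0, hc, h⟩ := exists_volume_restrict_le hρ hpos hK
  exact (hf.smul_measure hc).mono_measure h

theorem locallyIntegrable_of_memLp (hρ : Continuous ρ) (hpos : ∀ x, 0 < ρ x)
    {F : Type*} [NormedAddCommGroup F]
    {f : E d → F} (hf : MemLp f 2 (wMeasure ρ)) : LocallyIntegrable f := by
  rw [locallyIntegrable_iff]
  intro K hK
  have : IsFiniteMeasure (volume.restrict K) := ⟨by simpa using hK.measure_lt_top⟩
  exact (memLp_restrict_of_wMeasure hρ hpos hf hK).integrable (by norm_num)

theorem eLpNorm_two_sq {α F : Type*} [MeasurableSpace α] [NormedAddCommGroup F] (f : α → F)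
    (μ : Measure α) : eLpNorm f 2 μ ^ 2 = ∫⁻ x, ‖f x‖ₑ ^ 2 ∂μ := by
  have := eLpNorm_nnreal_pow_eq_lintegral (f := f) (μ := μ) (p := 2) (by norm_num)
  simpa using this

/-! ### Test functions, weak gradients and the space `H¹(ρ)`. -/

theorem continuous_gradient {f : E d → ℝ} (hf : ContDiff ℝ 1 f) : Continuous (gradient f) :=
  (InnerProductSpace.toDual ℝ (E d)).symm.continuous.comp (hf.continuous_fderiv one_ne_zero)

theorem hasCompactSupport_gradient {f : E d → ℝ} (hf : HasCompactSupport f) :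
    HasCompactSupport (gradient f) :=
  (hf.fderiv (𝕜 := ℝ)).comp_left (g := (InnerProductSpace.toDual ℝ (E d)).symm) (map_zero _)

theorem norm_gradient (f : E d → ℝ) (x : E d) : ‖gradient f x‖ = ‖fderiv ℝ f x‖ :=
  (InnerProductSpace.toDual ℝ (E d)).symm.norm_map _

theorem IsTest.contDiff_one {ψ : E d → ℝ} (h : IsTest ψ) : ContDiff ℝ 1 ψ :=
  h.1.of_le (by norm_cast)

theorem IsTest.differentiable {ψ : E d → ℝ} (h : IsTest ψ) : Differentiable ℝ ψ :=
  h.contDiff_one.differentiable (by norm_num)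

theorem IsTest.continuous {ψ : E d → ℝ} (h : IsTest ψ) : Continuous ψ := h.1.continuous

theorem IsTest.continuous_gradient {ψ : E d → ℝ} (h : IsTest ψ) : Continuous (gradient ψ) :=
  L2Opt.continuous_gradient h.contDiff_one

theorem IsTest.mul_left {χ ψ : E d → ℝ} (hχ : ContDiff ℝ ∞ χ) (h : IsTest ψ) :
    IsTest (fun x => χ x * ψ x) :=
  ⟨hχ.mul h.1, h.2.mul_left⟩

theorem integrable_inner_of_hasCompactSupport {μ : Measure (E d)} {u g : E d → E d}
    (hu : LocallyIntegrable u μ) (hg : Continuous g) (hg' : HasCompactSupport g) :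
    Integrable (fun x => inner ℝ (u x) (g x)) μ := by
  refine (hu.integrable_smul_left_of_hasCompactSupport hg.norm hg'.norm).mono
    (hu.aestronglyMeasurable.inner hg.aestronglyMeasurable) (Eventually.of_forall fun x => ?_)
  rw [norm_smul, norm_norm, mul_comm]
  exact norm_inner_le_norm _ _

theorem integrable_mul_of_hasCompactSupport {μ : Measure (E d)} {φ g : E d → ℝ}
    (hφ : LocallyIntegrable φ μ) (hg : Continuous g) (hg' : HasCompactSupport g) :
    Integrable (fun x => φ x * g x) μ :=
  hφ.integrable_smul_right_of_hasCompactSupport hg hg'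

theorem IsTest.continuous_fderiv_apply {ψ : E d → ℝ} (h : IsTest ψ) (e : E d) :
    Continuous fun x => fderiv ℝ ψ x e :=
  (h.contDiff_one.continuous_fderiv one_ne_zero).clm_apply continuous_const

theorem HasWeakGradient.integrable_left {φ : E d → ℝ} {G : E d → E d} (h : HasWeakGradient φ G)
    {ψ : E d → ℝ} (hψ : IsTest ψ) (e : E d) : Integrable fun x => φ x * fderiv ℝ ψ x e :=
  integrable_mul_of_hasCompactSupport h.locallyIntegrable (hψ.continuous_fderiv_apply e)
    (hψ.2.fderiv_apply (𝕜 := ℝ) e)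

theorem locallyIntegrable_inner_const {G : E d → E d} (h : LocallyIntegrable G) (e : E d) :
    LocallyIntegrable fun x => inner ℝ (G x) e := fun x =>
  let ⟨s, hs, hi⟩ := h x
  ⟨s, hs, hi.inner_const e⟩

theorem HasWeakGradient.integrable_right {φ : E d → ℝ} {G : E d → E d} (h : HasWeakGradient φ G)
    {ψ : E d → ℝ} (hψ : IsTest ψ) (e : E d) : Integrable fun x => inner ℝ (G x) e * ψ x :=
  integrable_mul_of_hasCompactSupport (locallyIntegrable_inner_const h.locallyIntegrable_grad e)
    hψ.continuous hψ.2

theorem HasWeakGradient.sub {φ φ' : E d → ℝ} {G G' : E d → E d} (h : HasWeakGradient φ G)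
    (h' : HasWeakGradient φ' G') :
    HasWeakGradient (fun x => φ x - φ' x) (fun x => G x - G' x) where
  locallyIntegrable := h.1.sub h'.1
  locallyIntegrable_grad := h.2.sub h'.2
  integral_eq ψ hψ e := by
    simp_rw [inner_sub_left, sub_mul]
    rw [integral_sub (h.integrable_left hψ e) (h'.integrable_left hψ e),
      integral_sub (h.integrable_right hψ e) (h'.integrable_right hψ e), h.3 ψ hψ e, h'.3 ψ hψ e]
    ring

theorem hasWeakGradient_of_contDiff {φ : E d → ℝ} (h : ContDiff ℝ 1 φ) :
    HasWeakGradient φ (gradient φ) where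
  locallyIntegrable := h.continuous.locallyIntegrable
  locallyIntegrable_grad := (continuous_gradient h).locallyIntegrable
  integral_eq ψ hψ e := by
    simp_rw [inner_gradient_left]
    have hc : Continuous fun x => fderiv ℝ φ x e :=
      (h.continuous_fderiv one_ne_zero).clm_apply continuous_const
    refine integral_mul_fderiv_eq_neg_fderiv_mul_of_integrable
      (integrable_mul_of_hasCompactSupport hc.locallyIntegrable hψ.continuous hψ.2)
      (integrable_mul_of_hasCompactSupport h.continuous.locallyIntegrable
        (hψ.continuous_fderiv_apply e) (hψ.2.fderiv_apply (𝕜 := ℝ) e))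
      (integrable_mul_of_hasCompactSupport h.continuous.locallyIntegrable hψ.continuous hψ.2)
      (fun x _ => h.differentiable (by norm_num) x) (fun x _ => hψ.differentiable x)

/-- The product `χψ` is itself a test function; testing `φ` against it and expanding its derivative
gives the Leibniz rule. -/
theorem HasWeakGradient.mul_left {φ χ : E d → ℝ} {G : E d → E d} (hχ : IsTest χ)
    (h : HasWeakGradient φ G) :
    HasWeakGradient (fun x => χ x * φ x) (fun x => χ x • G x + φ x • gradient χ x) where
  locallyIntegrable :=
    (h.1.integrable_smul_left_of_hasCompactSupport hχ.continuous hχ.2).locallyIntegrable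
  locallyIntegrable_grad :=
    (h.2.integrable_smul_left_of_hasCompactSupport hχ.continuous hχ.2).locallyIntegrable.add
      (h.1.integrable_smul_right_of_hasCompactSupport hχ.continuous_gradient
        (hasCompactSupport_gradient hχ.2)).locallyIntegrable
  integral_eq ψ hψ e := by
    have hχψ : IsTest fun x => χ x * ψ x := hψ.mul_left hχ.1
    have h1 := h.3 _ hχψ e
    have i1 := h.integrable_left hχψ e
    have i2 := h.integrable_right hχψ e
    have i3 : Integrable fun x => φ x * (fderiv ℝ χ x e * ψ x) :=
      integrable_mul_of_hasCompactSupport h.1 ((hχ.continuous_fderiv_apply e).mul hψ.continuous)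
        hψ.2.mul_left
    have e1 : (fun x => χ x * φ x * fderiv ℝ ψ x e) = fun x =>
        φ x * fderiv ℝ (fun x => χ x * ψ x) x e - φ x * (fderiv ℝ χ x e * ψ x) := by
      ext x
      rw [fderiv_fun_mul (hχ.differentiable x) (hψ.differentiable x)]
      simp only [add_apply, smul_apply, smul_eq_mul]
      ring
    have e2 : (fun x => inner ℝ (χ x • G x + φ x • gradient χ x) e * ψ x) = fun x =>
        inner ℝ (G x) e * (χ x * ψ x) + φ x * (fderiv ℝ χ x e * ψ x) := by
      ext x
      rw [inner_add_left, real_inner_smul_left, real_inner_smul_left, inner_gradient_left]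
      ring
    rw [e1, e2, integral_sub i1 i3, integral_add i2 i3, h1]
    ring

theorem continuous_memLp_of_hasCompactSupport {F : Type*} [NormedAddCommGroup F]
    {μ : Measure (E d)} [IsFiniteMeasure μ] {f : E d → F} (hf : Continuous f)
    (hf' : HasCompactSupport f) : MemLp f 2 μ :=
  (hf.memLp_top_of_hasCompactSupport hf' μ).mono_exponent le_top

theorem IsTest.inH1 [IsFiniteMeasure (wMeasure ρ)] {ψ : E d → ℝ} (h : IsTest ψ) :
    InH1 ρ ψ (gradient ψ) where
  memLp := continuous_memLp_of_hasCompactSupport h.continuous h.2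
  hasWeakGradient := hasWeakGradient_of_contDiff h.contDiff_one
  memLp_grad := continuous_memLp_of_hasCompactSupport h.continuous_gradient
    (hasCompactSupport_gradient h.2)

theorem inH1_const [IsFiniteMeasure (wMeasure ρ)] (c : ℝ) :
    InH1 ρ (fun _ => c) (fun _ => 0) where
  memLp := memLp_const c
  hasWeakGradient := by
    have := hasWeakGradient_of_contDiff (d := d) (φ := fun _ => c) contDiff_const
    have hg : gradient (fun _ : E d => c) = fun _ => 0 := by
      ext1 x; exact gradient_fun_const x c
    rwa [hg] at this
  memLp_grad := MemLp.zero'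

theorem InH1.sub {φ φ' : E d → ℝ} {G G' : E d → E d} (h : InH1 ρ φ G) (h' : InH1 ρ φ' G') :
    InH1 ρ (fun x => φ x - φ' x) (fun x => G x - G' x) :=
  ⟨h.1.sub h'.1, h.2.sub h'.2, h.3.sub h'.3⟩

theorem InH1.mul_left {φ χ : E d → ℝ} {G : E d → E d} (hχ : IsTest χ) (h : InH1 ρ φ G) :
    InH1 ρ (fun x => χ x * φ x) (fun x => χ x • G x + φ x • gradient χ x) := by
  have hχ' := hχ.continuous.memLp_top_of_hasCompactSupport hχ.2 (wMeasure ρ)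
  have hg := hχ.continuous_gradient.memLp_top_of_hasCompactSupport
    (hasCompactSupport_gradient hχ.2) (wMeasure ρ)
  have h1 : MemLp (χ • φ) 2 (wMeasure ρ) := h.1.smul hχ'
  have h2 : MemLp (χ • G) 2 (wMeasure ρ) := h.3.smul hχ'
  have h3 : MemLp (φ • gradient χ) 2 (wMeasure ρ) := hg.smul h.1
  exact ⟨h1, h.2.mul_left hχ, h2.add h3⟩

/-! ### Density of test functions in `H¹(ρ)`: cutoff and mollification. -/

/-- Smooth cutoffs equal to `1` on large balls, with uniformly small gradients. -/
theorem exists_cutoff (d : ℕ) : ∃ χ : ℕ → E d → ℝ, (∀ n, IsTest (χ n)) ∧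
    (∀ n x, |χ n x| ≤ 1) ∧ (∀ (n : ℕ) x, ‖x‖ ≤ n + 1 → χ n x = 1) ∧
    ∃ C : ℝ, ∀ (n : ℕ) x, ‖gradient (χ n) x‖ ≤ C / (n + 1) := by
  -- A single bump, equal to 1 on the unit ball, is dilated by `n + 1`; the chain rule then supplies
  -- the factor `1/(n + 1)` in the gradient bound.
  let b : ContDiffBump (0 : E d) := ⟨1, 2, by norm_num, by norm_num⟩
  have hb : IsTest (b : E d → ℝ) := ⟨b.contDiff, b.hasCompactSupport⟩
  obtain ⟨C, hC⟩ := (hasCompactSupport_gradient hb.2).exists_bound_of_continuous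
    hb.continuous_gradient
  have hn : ∀ n : ℕ, ((n : ℝ) + 1) ≠ 0 := fun n => by positivity
  refine ⟨fun n x => b (((n : ℝ) + 1)⁻¹ • x), fun n => ⟨?_, ?_⟩, fun n x => ?_, fun n x hx => ?_,
    C, fun n x => ?_⟩
  · exact b.contDiff.comp (contDiff_const_smul _)
  · exact b.hasCompactSupport.comp_homeomorph (Homeomorph.smulOfNeZero _ (inv_ne_zero (hn n)))
  · rw [abs_of_nonneg b.nonneg]
    exact b.le_one
  · apply b.one_of_mem_closedBall
    rw [mem_closedBall_zero_iff, norm_smul, norm_inv, Real.norm_of_nonneg (by positivity)]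
    exact (inv_mul_le_one₀ (by positivity)).2 hx
  · rw [norm_gradient, fderiv_comp_smul, norm_smul, norm_inv,
      Real.norm_of_nonneg (by positivity : (0 : ℝ) ≤ n + 1), div_eq_inv_mul, ← norm_gradient]
    gcongr
    exact hC _

open scoped Convolution
open ContinuousLinearMap (lsmul)

/-- Translation is continuous in `L²`. -/
theorem exists_eLpNorm_translate_sub_le {F : Type*} [NormedAddCommGroup F] {f : E d → F}
    (hf : MemLp f 2 volume) {ε : ℝ≥0∞} (hε : ε ≠ 0) :
    ∃ δ > 0, ∀ y : E d, ‖y‖ < δ → eLpNorm (fun x => f (x - y) - f x) 2 volume ≤ ε := by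
  have hmp (y : E d) : MeasurePreserving (fun x => x - y) (volume : Measure (E d)) volume :=
    measurePreserving_sub_right volume y
  have hc : Continuous fun y : E d => Lp.compMeasurePreserving _ (hmp y) (hf.toLp f) := by
    let g : C(E d, C(E d, E d)) :=
      (ContinuousMap.mk (fun a : E d × E d ↦ a.2 - a.1) (by fun_prop)).curry
    exact (continuous_const (y := hf.toLp f)).compMeasurePreservingLp g.continuous hmp (by norm_num)
  have ht := (tendsto_iff_edist_tendsto_0.1 (hc.tendsto 0))
  obtain ⟨δ, hδ, h⟩ := Metric.eventually_nhds_iff.1 ((ENNReal.tendsto_nhds_zero.1 ht) ε hε.bot_lt)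
  refine ⟨δ, hδ, fun y hy => ?_⟩
  have h1 := h (by simpa using hy)
  rw [Lp.edist_def] at h1
  refine le_trans (le_of_eq (eLpNorm_congr_ae ?_)) h1
  have a0 := Lp.coeFn_compMeasurePreserving (hf.toLp f) (hmp 0)
  have ay := Lp.coeFn_compMeasurePreserving (hf.toLp f) (hmp y)
  filter_upwards [a0, ay, hf.coeFn_toLp, (hmp y).quasiMeasurePreserving.ae hf.coeFn_toLp]
    with x h0 h1 h2 h3
  rw [Pi.sub_apply, h0, h1]
  simp [h2, h3]

/-- Averages against a probability density are controlled in `L²` by translations. -/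
theorem eLpNorm_convolution_sub_le {F : Type*} [NormedAddCommGroup F] [NormedSpace ℝ F]
    [CompleteSpace F] {f : E d → F}
    (hf : MemLp f 2 volume) {η : E d → ℝ} (hη : Continuous η) (hη' : HasCompactSupport η)
    (hη0 : ∀ x, 0 ≤ η x) (hη1 : ∫ x, η x = 1) {ε : ℝ≥0∞}
    (h : ∀ y ∈ Function.support η, eLpNorm (fun x => f (x - y) - f x) 2 volume ≤ ε) :
    eLpNorm (fun x => (η ⋆[lsmul ℝ ℝ, volume] f) x - f x) 2 volume ≤ ε := by
  -- Under the probability measure `η dy`, the mollification error at `x` is the average of `f (x -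
  -- y) - f x`, so Jensen bounds its square by the average square. Tonelli then reduces the claim to
  -- translations by points of the support.
  set ν : Measure (E d) := volume.withDensity fun y => ENNReal.ofReal (η y) with hν
  have hη_int : Integrable η := hη.integrable_of_hasCompactSupport hη'
  have hνac : ν ≪ volume := withDensity_absolutelyContinuous _ _
  have hνprob : IsProbabilityMeasure ν := by
    constructor
    rw [hν, withDensity_apply _ MeasurableSet.univ, setLIntegral_univ,
      ← ofReal_integral_eq_lintegral_ofReal hη_int (Eventually.of_forall hη0),
      hη1, ENNReal.ofReal_one]
  have hfl : LocallyIntegrable f := hf.locallyIntegrable (by norm_num)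
  have hmeas (x : E d) : AEStronglyMeasurable (fun y => f (x - y)) volume :=
    hf.1.comp_quasiMeasurePreserving
      (quasiMeasurePreserving_sub_left_of_right_invariant volume x)
  have hconv (x : E d) : (η ⋆[lsmul ℝ ℝ, volume] f) x - f x = ∫ y, (f (x - y) - f x) ∂ν := by
    have hi : Integrable fun y => η y • f (x - y) :=
      hη'.convolutionExists_left (lsmul ℝ ℝ) hη hfl x
    rw [hν, integral_withDensity_eq_integral_toReal_smul (by fun_prop) (by simp)]
    simp_rw [ENNReal.toReal_ofReal (hη0 _), smul_sub]
    rw [integral_sub hi (hη_int.smul_const _), integral_smul_const, hη1, one_smul,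
      convolution_lsmul]
  have hjensen (x : E d) : ‖(η ⋆[lsmul ℝ ℝ, volume] f) x - f x‖ₑ ^ 2 ≤
      ∫⁻ y, ‖f (x - y) - f x‖ₑ ^ 2 ∂ν := by
    rw [hconv, ← eLpNorm_two_sq]
    gcongr
    refine (enorm_integral_le_lintegral_enorm _).trans ?_
    rw [← eLpNorm_one_eq_lintegral_enorm]
    exact eLpNorm_le_eLpNorm_of_exponent_le (by norm_num)
      (((hmeas x).mono_ac hνac).sub aestronglyMeasurable_const)
  have hswap_meas : AEMeasurable (Function.uncurry fun x y => ‖f (x - y) - f x‖ₑ ^ 2)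
      ((volume : Measure (E d)).prod ν) := by
    have hac : (volume : Measure (E d)).prod ν ≪ volume.prod volume :=
      Measure.AbsolutelyContinuous.rfl.prod hνac
    have h1 : AEStronglyMeasurable (fun p : E d × E d => f (p.1 - p.2)) (volume.prod ν) :=
      (hf.1.comp_quasiMeasurePreserving
        (quasiMeasurePreserving_sub_of_right_invariant volume volume)).mono_ac hac
    have h2 : AEStronglyMeasurable (fun p : E d × E d => f p.1) (volume.prod ν) :=
      hf.1.comp_fst
    exact (h1.sub h2).enorm.pow_const 2
  rw [← ENNReal.pow_le_pow_left_iff two_ne_zero, eLpNorm_two_sq]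
  calc ∫⁻ x, ‖(η ⋆[lsmul ℝ ℝ, volume] f) x - f x‖ₑ ^ 2
      ≤ ∫⁻ x, ∫⁻ y, ‖f (x - y) - f x‖ₑ ^ 2 ∂ν := lintegral_mono hjensen
    _ = ∫⁻ y, (∫⁻ x, ‖f (x - y) - f x‖ₑ ^ 2) ∂ν := lintegral_lintegral_swap hswap_meas
    _ ≤ ∫⁻ _, ε ^ 2 ∂ν := by
      refine lintegral_mono_ae ?_
      have hs : ∀ᵐ y ∂ν, y ∈ Function.support η := by
        rw [hν, ae_withDensity_iff (by fun_prop)]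
        refine Eventually.of_forall fun y hy => ?_
        rw [Function.mem_support]
        rintro h0
        simp [h0] at hy
      filter_upwards [hs] with y hy
      rw [← eLpNorm_two_sq]
      gcongr
      exact h y hy
    _ = ε ^ 2 := by simp

/-- The weak gradient identity is tested against `t ↦ η (x - t)`; the sign from the reflection
cancels the sign from integration by parts. -/
theorem HasWeakGradient.gradient_convolution {φ : E d → ℝ} {G : E d → E d}
    (h : HasWeakGradient φ G) {η : E d → ℝ} (hη : IsTest η) :
    gradient (η ⋆[lsmul ℝ ℝ, volume] φ) = η ⋆[lsmul ℝ ℝ, volume] G := by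
  ext1 x
  refine ext_inner_right ℝ fun e => ?_
  have hd := hη.2.hasFDerivAt_convolution_left (lsmul ℝ ℝ) hη.contDiff_one
    h.locallyIntegrable x
  have hψ : IsTest fun t => η (x - t) :=
    ⟨hη.1.comp (contDiff_const.sub contDiff_id), hη.2.comp_homeomorph (Homeomorph.subLeft x)⟩
  have hdψ (t : E d) : fderiv ℝ (fun t => η (x - t)) t e = -fderiv ℝ η (x - t) e := by
    have h1 := (hη.differentiable (x - t)).hasFDerivAt.comp t
      ((hasFDerivAt_const x t).sub (hasFDerivAt_id t))
    have h2 : fderiv ℝ (fun t => η (x - t)) t = _ := h1.fderiv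
    rw [h2]
    simp
  have key := h.integral_eq _ hψ e
  simp_rw [hdψ] at key
  have iG : Integrable fun t => η (x - t) • G t :=
    h.2.integrable_smul_left_of_hasCompactSupport hψ.continuous hψ.2
  have hD : HasCompactSupport fun t => fderiv ℝ η (x - t) :=
    (hη.2.fderiv (𝕜 := ℝ)).comp_homeomorph (Homeomorph.subLeft x)
  have hDc : Continuous fun t => fderiv ℝ η (x - t) :=
    (hη.contDiff_one.continuous_fderiv one_ne_zero).comp (continuous_const.sub continuous_id)
  have iD : Integrable fun t => φ t • fderiv ℝ η (x - t) :=
    h.1.integrable_smul_right_of_hasCompactSupport hDc hD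
  have e1 : (fderiv ℝ η ⋆[(lsmul ℝ ℝ).precompL (E d), volume] φ) x =
      ∫ t, φ t • fderiv ℝ η (x - t) := by
    rw [convolution_eq_swap]
    congr 1
    ext1 t
    ext v
    simp [mul_comm]
  rw [inner_gradient_left, hd.fderiv, e1, ContinuousLinearMap.integral_apply iD,
    convolution_lsmul_swap, real_inner_comm, ← integral_inner iG]
  simp_rw [real_inner_smul_right, smul_apply, smul_eq_mul]
  simp_rw [mul_neg, integral_neg, neg_inj] at key
  rw [key]
  congr 1
  ext1 t
  rw [real_inner_comm, mul_comm]

/-- With mollifier radius below 1 the error lives in the ball of radius `1 + R`, where `ρ dx ≤ c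
dx`. It therefore suffices to make the Lebesgue error at most `ε / √c`. -/
theorem exists_eLpNorm_sub_convolution_le {F : Type*} [NormedAddCommGroup F] [NormedSpace ℝ F]
    [CompleteSpace F] (hρ : Continuous ρ) {f : E d → F} (hf : MemLp f 2 volume) {R : ℝ}
    (hR : Function.support f ⊆ Metric.closedBall 0 R) {ε : ℝ≥0∞} (hε : ε ≠ 0) :
    ∃ δ > 0, ∀ b : ContDiffBump (0 : E d), b.rOut < δ →
      eLpNorm (fun x => f x - (b.normed volume ⋆[lsmul ℝ ℝ, volume] f) x) 2 (wMeasure ρ) ≤ ε := by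
  obtain ⟨c, hc0, hc, hK⟩ := exists_wMeasure_restrict_le hρ
    (isCompact_closedBall (0 : E d) (1 + R))
  have hc' : c ^ (1 / 2 : ℝ) ≠ ⊤ := ENNReal.rpow_ne_top_of_nonneg (by norm_num) hc
  have hc0' : c ^ (1 / 2 : ℝ) ≠ 0 := by simp [hc0, hc]
  obtain ⟨δ, hδ, h⟩ := exists_eLpNorm_translate_sub_le hf
    (ε := ε / c ^ (1 / 2 : ℝ)) (ENNReal.div_ne_zero.2 ⟨hε, hc'⟩)
  refine ⟨min δ 1, by positivity, fun b hb => ?_⟩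
  have hball : Function.support (b.normed volume ⋆[lsmul ℝ ℝ, volume] f) ⊆
      Metric.closedBall (0 : E d) (1 + R) := by
    refine (support_convolution_subset _).trans ?_
    rintro _ ⟨y, hy, z, hz, rfl⟩
    rw [b.support_normed_eq, mem_ball_zero_iff] at hy
    have hz' := mem_closedBall_zero_iff.1 (hR hz)
    rw [mem_closedBall_zero_iff]
    have := hb.trans_le (min_le_right _ _)
    exact (norm_add_le _ _).trans (by linarith)
  have hsupp : Function.support (fun x => f x - (b.normed volume ⋆[lsmul ℝ ℝ, volume] f) x) ⊆
      Metric.closedBall (0 : E d) (1 + R) :=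
    (Function.support_sub _ _).trans (Set.union_subset
      (hR.trans (Metric.closedBall_subset_closedBall (by linarith))) hball)
  have hconv := eLpNorm_convolution_sub_le hf (b.continuous_normed (μ := volume))
    b.hasCompactSupport_normed b.nonneg_normed b.integral_normed (ε := ε / c ^ (1 / 2 : ℝ))
    (fun y hy => h y (by
      rw [b.support_normed_eq, mem_ball_zero_iff] at hy
      exact hy.trans (hb.trans_le (min_le_left _ _))))
  rw [← eLpNorm_restrict_eq_of_support_subset hsupp]
  refine (eLpNorm_restrict_le_of_measure_le hc0 hK _).trans ?_
  calc _ ≤ c ^ (1 / 2 : ℝ) * (ε / c ^ (1 / 2 : ℝ)) := by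
        gcongr
        refine (eLpNorm_restrict_le _ _ _ _).trans (le_trans (le_of_eq ?_) hconv)
        rw [← eLpNorm_neg]
        congr 1
        ext1 x
        simp
    _ = ε := ENNReal.mul_div_cancel hc0' hc'

theorem memLp_volume_of_support_subset {F : Type*} [NormedAddCommGroup F]
    (hρ : Continuous ρ) (hpos : ∀ x, 0 < ρ x) {f : E d → F} (hf : MemLp f 2 (wMeasure ρ)) {R : ℝ}
    (hR : Function.support f ⊆ Metric.closedBall 0 R) : MemLp f 2 volume := by
  have := memLp_restrict_of_wMeasure hρ hpos hf (isCompact_closedBall (0 : E d) R)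
  rw [← memLp_indicator_iff_restrict measurableSet_closedBall] at this
  rwa [Set.indicator_eq_self.2 hR] at this

theorem InH1.exists_test_of_support_subset (hρ : Continuous ρ) (hpos : ∀ x, 0 < ρ x)
    {φ : E d → ℝ} {G : E d → E d} (h : InH1 ρ φ G) {R : ℝ}
    (hφ : Function.support φ ⊆ Metric.closedBall 0 R)
    (hG : Function.support G ⊆ Metric.closedBall 0 R) {ε : ℝ≥0∞} (hε : ε ≠ 0) :
    ∃ ψ, IsTest ψ ∧ eLpNorm (fun x => φ x - ψ x) 2 (wMeasure ρ) ≤ ε ∧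
      eLpNorm (fun x => G x - gradient ψ x) 2 (wMeasure ρ) ≤ ε := by
  obtain ⟨δ₁, hδ₁, h₁⟩ := exists_eLpNorm_sub_convolution_le hρ
    (memLp_volume_of_support_subset hρ hpos h.memLp hφ) hφ hε
  obtain ⟨δ₂, hδ₂, h₂⟩ := exists_eLpNorm_sub_convolution_le hρ
    (memLp_volume_of_support_subset hρ hpos h.memLp_grad hG) hG hε
  have hδ : 0 < min δ₁ δ₂ := lt_min hδ₁ hδ₂
  let b : ContDiffBump (0 : E d) := ⟨min δ₁ δ₂ / 4, min δ₁ δ₂ / 2, by positivity, by linarith⟩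
  have hb : b.rOut < min δ₁ δ₂ := half_lt_self hδ
  have hη : IsTest (b.normed volume) := ⟨b.contDiff_normed, b.hasCompactSupport_normed⟩
  have hφc : HasCompactSupport φ :=
    HasCompactSupport.of_support_subset_isCompact (isCompact_closedBall 0 R) hφ
  refine ⟨b.normed volume ⋆[lsmul ℝ ℝ, volume] φ, ⟨?_, hη.2.convolution _ hφc⟩,
    h₁ b (hb.trans_le (min_le_left _ _)), ?_⟩
  · exact hη.2.contDiff_convolution_left _ hη.1 h.hasWeakGradient.locallyIntegrable
  · rw [h.hasWeakGradient.gradient_convolution hη]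
    exact h₂ b (hb.trans_le (min_le_right _ _))

/-- Dominated convergence for the squares, with majorant `4|f|²`: at each point the error vanishes
once `n ≥ |x|`. -/
theorem tendsto_eLpNorm_sub_cutoff {F : Type*} [NormedAddCommGroup F] [NormedSpace ℝ F]
    {μ : Measure (E d)} {f : E d → F} (hf : MemLp f 2 μ) {χ : ℕ → E d → ℝ}
    (hχ : ∀ n, Continuous (χ n)) (hχ1 : ∀ n x, |χ n x| ≤ 1)
    (hχ2 : ∀ (n : ℕ) x, ‖x‖ ≤ n + 1 → χ n x = 1) :
    Tendsto (fun n => eLpNorm (fun x => f x - χ n x • f x) 2 μ) atTop (𝓝 0) := by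
  have key : Tendsto (fun n => ∫⁻ x, ‖f x - χ n x • f x‖ₑ ^ 2 ∂μ) atTop
      (𝓝 (∫⁻ _, 0 ∂μ)) := by
    refine tendsto_lintegral_of_dominated_convergence' (fun x => (2 * ‖f x‖ₑ) ^ 2) (fun n => ?_)
      (fun n => Eventually.of_forall fun x => ?_) ?_ (Eventually.of_forall fun x => ?_)
    · exact (hf.1.sub ((hχ n).aestronglyMeasurable.smul hf.1)).enorm.pow_const 2
    · show ‖f x - χ n x • f x‖ₑ ^ 2 ≤ (2 * ‖f x‖ₑ) ^ 2
      gcongr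
      refine (enorm_sub_le).trans ?_
      rw [enorm_smul, two_mul]
      gcongr
      refine mul_le_of_le_one_left' ?_
      rw [← ofReal_norm, Real.norm_eq_abs]
      exact ENNReal.ofReal_le_one.2 (hχ1 n x)
    · simp_rw [mul_pow]
      rw [lintegral_const_mul' _ _ (by norm_num), ← eLpNorm_two_sq]
      exact ENNReal.mul_ne_top (by norm_num) (ENNReal.pow_ne_top hf.eLpNorm_ne_top)
    · refine tendsto_const_nhds.congr' ?_
      filter_upwards [eventually_ge_atTop ⌈‖x‖⌉₊] with n hn
      have : ‖x‖ ≤ n := (Nat.le_ceil _).trans (by exact_mod_cast hn)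
      simp [hχ2 n x (by linarith)]
  simp_rw [← eLpNorm_two_sq, lintegral_zero] at key
  have := (ENNReal.continuous_rpow_const (y := 1 / 2)).tendsto 0 |>.comp key
  simp only [one_div, ENNReal.zero_rpow_of_pos (by norm_num : (0 : ℝ) < 2⁻¹)] at this
  refine this.congr fun n => ?_
  simp only [Function.comp]
  rw [← ENNReal.rpow_natCast, ← ENNReal.rpow_mul]
  norm_num

/-- Test functions are dense in `H¹(ℝ^d; ρ)`. -/
theorem InH1.exists_test (hρ : Continuous ρ) (hpos : ∀ x, 0 < ρ x)
    {φ : E d → ℝ} {G : E d → E d} (h : InH1 ρ φ G) {ε : ℝ≥0∞} (hε : ε ≠ 0) :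
    ∃ ψ, IsTest ψ ∧ eLpNorm (fun x => φ x - ψ x) 2 (wMeasure ρ) ≤ ε ∧
      eLpNorm (fun x => G x - gradient ψ x) 2 (wMeasure ρ) ≤ ε := by
  obtain ⟨χ, hχ, hχ1, hχ2, C, hC⟩ := exists_cutoff d
  have hε3 : ε / 3 ≠ 0 := ENNReal.div_ne_zero.2 ⟨hε, by norm_num⟩
  have hle : ε / 3 + ε / 3 + ε / 3 = ε := ENNReal.add_thirds ε
  have t1 := tendsto_eLpNorm_sub_cutoff h.memLp (fun n => (hχ n).continuous) hχ1 hχ2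
  have t2 := tendsto_eLpNorm_sub_cutoff h.memLp_grad (fun n => (hχ n).continuous) hχ1 hχ2
  -- The gradient of `χφ` contains the extra term `φ∇χ`, which vanishes in the limit because `∇χ =
  -- O(1/n)`. With the cutoff error of `G` and the mollification error, this accounts for the three
  -- thirds of `ε`.
  have t3 : Tendsto (fun n : ℕ => ENNReal.ofReal (C / (n + 1)) * eLpNorm φ 2 (wMeasure ρ)) atTop
      (𝓝 0) := by
    have : Tendsto (fun n : ℕ => C / ((n : ℝ) + 1)) atTop (𝓝 0) :=
      tendsto_const_nhds.div_atTop (tendsto_natCast_atTop_atTop.atTop_add tendsto_const_nhds)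
    have := ENNReal.Tendsto.mul_const (ENNReal.tendsto_ofReal this)
      (b := eLpNorm φ 2 (wMeasure ρ)) (Or.inr h.memLp.eLpNorm_ne_top)
    simpa using this
  obtain ⟨n, h1, h2, h3⟩ := ((t1.eventually_le_const hε3.bot_lt).and
    ((t2.eventually_le_const hε3.bot_lt).and (t3.eventually_le_const hε3.bot_lt))).exists
  obtain ⟨R, hR⟩ := (hχ n).2.isBounded.subset_closedBall 0
  have hRχ : Function.support (χ n) ⊆ Metric.closedBall 0 R := subset_closure.trans hR
  have hRg : Function.support (gradient (χ n)) ⊆ Metric.closedBall 0 R := by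
    refine Set.Subset.trans ?_ hR
    refine Set.Subset.trans (fun x hx => ?_) (support_fderiv_subset ℝ (f := χ n))
    rw [Function.mem_support, ← norm_ne_zero_iff, norm_gradient, norm_ne_zero_iff] at hx
    exact hx
  have hn := h.mul_left (hχ n)
  have hs1 : Function.support (fun x => χ n x * φ x) ⊆ Metric.closedBall 0 R :=
    (Function.support_mul_subset_left _ _).trans hRχ
  have hs2 : Function.support (fun x => χ n x • G x + φ x • gradient (χ n) x) ⊆
      Metric.closedBall 0 R :=
    (Function.support_add _ _).trans (Set.union_subset
      ((Function.support_smul_subset_left _ _).trans hRχ)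
      (fun x hx => hRg fun h0 => hx (by simp [h0])))
  obtain ⟨ψ, hψ, e1, e2⟩ := hn.exists_test_of_support_subset hρ hpos hs1 hs2 hε3
  have hψm : AEStronglyMeasurable ψ (wMeasure ρ) := hψ.continuous.aestronglyMeasurable
  have hψm' : AEStronglyMeasurable (gradient ψ) (wMeasure ρ) :=
    hψ.continuous_gradient.aestronglyMeasurable
  have hχm : AEStronglyMeasurable (χ n) (wMeasure ρ) := (hχ n).continuous.aestronglyMeasurable
  have hgm : AEStronglyMeasurable (fun x => φ x • gradient (χ n) x) (wMeasure ρ) :=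
    h.memLp.1.smul (hχ n).continuous_gradient.aestronglyMeasurable
  refine ⟨ψ, hψ, ?_, ?_⟩
  · have e : (fun x => φ x - ψ x) =
        (fun x => φ x - χ n x • φ x) + fun x => χ n x * φ x - ψ x := by
      ext x; simp
    rw [e]
    calc _ ≤ ε / 3 + ε / 3 := (eLpNorm_add_le (h.memLp.1.sub (hχm.smul h.memLp.1))
          (hn.memLp.1.sub hψm) (by norm_num)).trans (add_le_add h1 e1)
      _ ≤ ε / 3 + ε / 3 + ε / 3 := le_self_add
      _ = ε := hle
  · have e : (fun x => G x - gradient ψ x) = ((fun x => G x - χ n x • G x) +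
        fun x => -(φ x • gradient (χ n) x)) +
        fun x => χ n x • G x + φ x • gradient (χ n) x - gradient ψ x := by
      ext1 x; simp only [Pi.add_apply]; abel
    have h3' : eLpNorm (fun x => -(φ x • gradient (χ n) x)) 2 (wMeasure ρ) ≤ ε / 3 := by
      refine le_trans (eLpNorm_le_mul_eLpNorm_of_ae_le_mul
        (Eventually.of_forall fun x => ?_) 2) h3
      rw [norm_neg, norm_smul, mul_comm]
      gcongr
      exact hC n x
    rw [e, ← hle]
    have m1 := h.memLp_grad.1.sub (hχm.smul h.memLp_grad.1)
    refine (eLpNorm_add_le (m1.add hgm.neg) (hn.memLp_grad.1.sub hψm') (by norm_num)).trans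
      (add_le_add ?_ e2)
    exact (eLpNorm_add_le m1 hgm.neg (by norm_num)).trans (add_le_add h2 h3')

/-! ### Lyapunov estimate: the gradient controls the `L²` norm outside a ball. -/

/-- The divergence of `x ↦ k(x) x` integrates to zero. -/
theorem integral_mul_add_fderiv_self {k : E d → ℝ} (hk : ContDiff ℝ 1 k)
    (hk' : HasCompactSupport k) : ∫ x, ((d : ℝ) * k x + fderiv ℝ k x x) = 0 := by
  let e : Fin d → E d := fun i => EuclideanSpace.basisFun (Fin d) ℝ i
  have hik : Integrable k := hk.continuous.integrable_of_hasCompactSupport hk'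
  have hc (i : Fin d) : Continuous fun x : E d => fderiv ℝ k x (e i) :=
    (hk.continuous_fderiv one_ne_zero).clm_apply continuous_const
  have hi (i : Fin d) : Integrable fun x : E d => x i * fderiv ℝ k x (e i) :=
    integrable_mul_of_hasCompactSupport (φ := fun x : E d => x i)
      (by fun_prop : Continuous fun x : E d => x i).locallyIntegrable (hc i)
      (hk'.fderiv_apply (𝕜 := ℝ) (e i))
  have hcoord (i : Fin d) (x : E d) : fderiv ℝ (fun x : E d => x i) x (e i) = 1 := by
    have : HasFDerivAt (fun x : E d => x i) (EuclideanSpace.proj i : E d →L[ℝ] ℝ) x :=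
      (EuclideanSpace.proj i : E d →L[ℝ] ℝ).hasFDerivAt
    rw [this.fderiv]
    simp [e]
  have hpart (i : Fin d) : ∫ x : E d, x i * fderiv ℝ k x (e i) = -∫ x, k x := by
    rw [integral_mul_fderiv_eq_neg_fderiv_mul_of_integrable (f := fun x : E d => x i)]
    · simp_rw [hcoord, one_mul]
    · simpa only [hcoord, one_mul] using hik
    · exact hi i
    · exact integrable_mul_of_hasCompactSupport (φ := fun x : E d => x i)
        (by fun_prop : Continuous fun x : E d => x i).locallyIntegrable hk.continuous hk'
    · intro x _; fun_prop
    · exact fun x _ => hk.differentiable one_ne_zero x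
  have hsum (x : E d) : fderiv ℝ k x x = ∑ i, x i * fderiv ℝ k x (e i) := by
    have hx : ∑ i, x i • e i = x := by
      simpa [e] using (EuclideanSpace.basisFun (Fin d) ℝ).sum_repr x
    calc fderiv ℝ k x x = fderiv ℝ k x (∑ i, x i • e i) := by rw [hx]
      _ = _ := by simp_rw [map_sum, map_smul, smul_eq_mul]
  have hker : Integrable fun x => ∑ i, x i * fderiv ℝ k x (e i) :=
    integrable_finsetSum _ fun i _ => hi i
  simp_rw [hsum]
  rw [integral_add (hik.const_mul _) hker, integral_finsetSum _ fun i _ => hi i,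
    integral_const_mul]
  simp [hpart]

/-- `(1 + |x|²)^{-1/2}`. -/
noncomputable def invBracket (x : E d) : ℝ := (√(1 + ‖x‖ ^ 2))⁻¹

theorem contDiff_invBracket : ContDiff ℝ 1 (invBracket : E d → ℝ) := by
  unfold invBracket
  refine ContDiff.inv (ContDiff.sqrt ?_ fun x => by positivity) fun x => by positivity
  exact contDiff_const.add (contDiff_norm_sq ℝ)

theorem invBracket_pos (x : E d) : 0 < invBracket x := by
  unfold invBracket
  positivity

theorem invBracket_le_one (x : E d) : invBracket x ≤ 1 :=
  inv_le_one_of_one_le₀ (Real.one_le_sqrt.2 (by nlinarith [sq_nonneg ‖x‖]))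

theorem norm_mul_invBracket_le_one (x : E d) : ‖x‖ * invBracket x ≤ 1 := by
  unfold invBracket
  rw [← div_eq_mul_inv]
  exact (div_le_one (by positivity)).2 (Real.le_sqrt_of_sq_le (by linarith))

theorem half_le_norm_mul_invBracket {x : E d} (hx : 1 ≤ ‖x‖) : 1 / 2 ≤ ‖x‖ * invBracket x := by
  unfold invBracket
  rw [← div_eq_mul_inv, le_div_iff₀ (by positivity)]
  have : √(1 + ‖x‖ ^ 2) ≤ 2 * ‖x‖ := Real.sqrt_le_iff.2 ⟨by positivity, by nlinarith⟩
  linarith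

/-- The bracket increases along rays, so its inverse decreases. This sign lets the corresponding
term be dropped in `integral_sq_le_of_test`. -/
theorem fderiv_invBracket_self_nonpos (x : E d) : fderiv ℝ (invBracket : E d → ℝ) x x ≤ 0 := by
  have h0 : (0 : ℝ) < 1 + ‖x‖ ^ 2 := by positivity
  have h1 : HasFDerivAt (fun y : E d => 1 + ‖y‖ ^ 2) (2 • innerSL ℝ x) x :=
    (hasStrictFDerivAt_norm_sq x).hasFDerivAt.const_add 1
  have h2 := (hasDerivAt_inv (Real.sqrt_pos.2 h0).ne').comp_hasFDerivAt x (h1.sqrt h0.ne')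
  have h3 : fderiv ℝ (invBracket : E d → ℝ) x = _ := h2.fderiv
  rw [h3]
  simp
  positivity

/-- Write `g = invBracket`. The divergence of `ρ f² g x` integrates to zero and equals `ρ` times `f²
(d g + x·∇g - g x·∇V) + 2 f g x·∇f`. Here `g ≤ 1`, `x·∇g ≤ 0`, and `|g x| ≤ 1` bounds the cross term
by `f² + |∇f|²`. The coefficient of `f²` is thus at most `d + 1 - g x·∇V`; the hypothesis has `d +
2`, and the spare unit becomes the left-hand side. -/
theorem integral_sq_le_of_test {V : E d → ℝ} (hV : ContDiff ℝ 2 V)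
    (hρV : ∀ x, ρ x = Real.exp (-V x)) {A R : ℝ}
    (hA : ∀ x, d + 2 - invBracket x * fderiv ℝ V x x ≤
      (Metric.closedBall (0 : E d) R).indicator (fun _ => A) x)
    {f : E d → ℝ} (hf : IsTest f) :
    ∫ x, f x ^ 2 ∂(wMeasure ρ) ≤ A * ∫ x in Metric.closedBall 0 R, f x ^ 2 ∂(wMeasure ρ) +
      ∫ x, ‖gradient f x‖ ^ 2 ∂(wMeasure ρ) := by
  have hρe : ρ = fun x => Real.exp (-V x) := funext hρV
  have hV1 : ContDiff ℝ 1 V := hV.of_le (by norm_num)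
  have hρ1 : ContDiff ℝ 1 ρ := by
    rw [hρe]; exact hV1.neg.exp
  have hρ : Continuous ρ := hρ1.continuous
  have hpos : ∀ x, 0 < ρ x := fun x => by rw [hρV]; positivity
  have hf1 := hf.contDiff_one
  set k : E d → ℝ := fun x => ρ x * (f x ^ 2 * invBracket x) with hk
  have hk1 : ContDiff ℝ 1 k := hρ1.mul ((hf1.pow 2).mul contDiff_invBracket)
  have hf2 : HasCompactSupport fun x => f x ^ 2 := hf.2.comp_left (g := fun y => y ^ 2) (by simp)
  have hk' : HasCompactSupport k := (hf2.mul_right).mul_left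
  have h0 := integral_mul_add_fderiv_self hk1 hk'
  have hder (x : E d) : fderiv ℝ k x x = ρ x * (-(fderiv ℝ V x x) * (f x ^ 2 * invBracket x) +
      (2 * f x * fderiv ℝ f x x * invBracket x + f x ^ 2 * fderiv ℝ invBracket x x)) := by
    have dρ : HasFDerivAt ρ (ρ x • -fderiv ℝ V x) x := by
      have := ((hV1.differentiable one_ne_zero x).hasFDerivAt.neg).exp
      rw [hρe]
      exact this
    have df := ((hf1.differentiable one_ne_zero x).hasFDerivAt.pow 2)
    have dg := (contDiff_invBracket.differentiable one_ne_zero x).hasFDerivAt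
    have : fderiv ℝ k x = _ := (dρ.mul (df.mul dg)).fderiv
    rw [this]
    simp
    ring
  have hgc := hf.continuous_gradient
  have hgs := hasCompactSupport_gradient hf.2
  have hg2 : HasCompactSupport fun x => ‖gradient f x‖ ^ 2 :=
    hgs.comp_left (g := fun y => ‖y‖ ^ 2) (by simp)
  have hfc := hf.continuous
  have i1 : Integrable fun x => ρ x * f x ^ 2 :=
    (hρ.mul (hfc.pow 2)).integrable_of_hasCompactSupport hf2.mul_left
  have i2 : Integrable fun x => ρ x * ‖gradient f x‖ ^ 2 :=
    (hρ.mul (hgc.norm.pow 2)).integrable_of_hasCompactSupport hg2.mul_left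
  have i3 : Integrable fun x =>
      (Metric.closedBall 0 R).indicator (fun x => A * (ρ x * f x ^ 2)) x :=
    (i1.const_mul A).indicator measurableSet_closedBall
  have i0 : Integrable fun x => (d : ℝ) * k x + fderiv ℝ k x x := by
    refine Continuous.integrable_of_hasCompactSupport ?_ ?_
    · exact (continuous_const.mul hk1.continuous).add
        ((hk1.continuous_fderiv one_ne_zero).clm_apply continuous_id)
    · refine hk'.mul_left.add ?_
      refine (hk'.fderiv (𝕜 := ℝ)).mono fun x hx h => hx ?_
      simp [h]
  have hpt (x : E d) : (d : ℝ) * k x + fderiv ℝ k x x ≤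
      ((Metric.closedBall 0 R).indicator (fun x => A * (ρ x * f x ^ 2)) x +
        ρ x * ‖gradient f x‖ ^ 2) - ρ x * f x ^ 2 := by
    have e1 : (Metric.closedBall 0 R).indicator (fun x => A * (ρ x * f x ^ 2)) x =
        (Metric.closedBall 0 R).indicator (fun _ => A) x * (ρ x * f x ^ 2) := by
      by_cases hx : x ∈ Metric.closedBall (0 : E d) R <;> simp [hx]
    have hg0 := invBracket_pos x
    have hg1 := invBracket_le_one x
    have hg2 := norm_mul_invBracket_le_one x
    have hDf : 2 * f x * fderiv ℝ f x x * invBracket x ≤ f x ^ 2 + ‖gradient f x‖ ^ 2 := by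
      have h1 : |fderiv ℝ f x x| * invBracket x ≤ ‖gradient f x‖ := by
        have := (fderiv ℝ f x).le_opNorm x
        rw [Real.norm_eq_abs, ← norm_gradient] at this
        calc _ ≤ ‖gradient f x‖ * ‖x‖ * invBracket x := by gcongr
          _ ≤ ‖gradient f x‖ := by
            rw [mul_assoc]; exact mul_le_of_le_one_right (norm_nonneg _) hg2
      have h2 : (fderiv ℝ f x x * invBracket x) ^ 2 ≤ ‖gradient f x‖ ^ 2 := by
        rw [← sq_abs, abs_mul, abs_of_pos hg0]
        gcongr
      nlinarith [sq_nonneg (f x - fderiv ℝ f x x * invBracket x)]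
    have hDg := fderiv_invBracket_self_nonpos x
    have hAx := hA x
    rw [e1, hder, hk]
    have hfin : (d : ℝ) * (f x ^ 2 * invBracket x) + (-(fderiv ℝ V x x) * (f x ^ 2 * invBracket x) +
        (2 * f x * fderiv ℝ f x x * invBracket x + f x ^ 2 * fderiv ℝ invBracket x x)) ≤
        (Metric.closedBall 0 R).indicator (fun _ => A) x * f x ^ 2 + ‖gradient f x‖ ^ 2
          - f x ^ 2 := by
      have a1 := mul_le_mul_of_nonneg_right hAx (sq_nonneg (f x))
      have a2 : f x ^ 2 * fderiv ℝ invBracket x x ≤ 0 :=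
        mul_nonpos_of_nonneg_of_nonpos (sq_nonneg _) hDg
      have a3 : (d : ℝ) * (f x ^ 2 * invBracket x) ≤ d * (f x ^ 2 * 1) := by gcongr
      nlinarith
    have := mul_le_mul_of_nonneg_left hfin (hpos x).le
    nlinarith
  have i32 : Integrable fun x => (Metric.closedBall 0 R).indicator
      (fun x => A * (ρ x * f x ^ 2)) x + ρ x * ‖gradient f x‖ ^ 2 := i3.add i2
  have hint := integral_mono i0 (i32.sub i1) hpt
  simp only [Pi.sub_apply] at hint
  rw [h0] at hint
  rw [integral_sub i32 i1, integral_add i3 i2,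
    integral_indicator measurableSet_closedBall, integral_const_mul] at hint
  have e2 : ∫ x in Metric.closedBall 0 R, f x ^ 2 ∂(wMeasure ρ) =
      ∫ x in Metric.closedBall 0 R, ρ x * f x ^ 2 := by
    rw [← integral_indicator measurableSet_closedBall, integral_wMeasure hρ hpos,
      ← integral_indicator measurableSet_closedBall]
    congr 1
    ext1 x
    by_cases hx : x ∈ Metric.closedBall (0 : E d) R <;> simp [hx]
  rw [e2, integral_wMeasure hρ hpos, integral_wMeasure hρ hpos]
  simp only [smul_eq_mul]
  linarith

/-- A function whose radial derivative tends to infinity satisfies the pointwise bound from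
which `integral_sq_le_of_test` is derived. -/
theorem exists_radial_bound {V : E d → ℝ} (hV : ContDiff ℝ 2 V)
    (hlim : liminf (radialDeriv V) (Bornology.cobounded (E d)) = ⊤) :
    ∃ A R : ℝ, 0 ≤ A ∧ 0 < R ∧ ∀ x, d + 2 - invBracket x * fderiv ℝ V x x ≤
      (Metric.closedBall (0 : E d) R).indicator (fun _ => A) x := by
  -- The threshold is twice `d + 2` because `|x| * invBracket x` is only known to be at least `1/2`,
  -- and that for `|x| ≥ 1`.
  have hev : ∀ᶠ x in Bornology.cobounded (E d),
      ((2 * (d + 2) : ℝ) : EReal) < radialDeriv V x :=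
    eventually_lt_of_lt_liminf (by rw [hlim]; exact EReal.coe_lt_top _)
  obtain ⟨R, hR⟩ : ∃ R : ℝ, ∀ x : E d, R < ‖x‖ →
      ((2 * (d + 2) : ℝ) : EReal) < radialDeriv V x := by
    have := (hasBasis_cobounded_norm (E := E d)).eventually_iff.1 hev
    obtain ⟨R, -, h⟩ := this
    exact ⟨R, fun x hx => h hx.le⟩
  have hV1 : ContDiff ℝ 1 V := hV.of_le (by norm_num)
  have hc : Continuous fun x : E d => d + 2 - invBracket x * fderiv ℝ V x x :=
    continuous_const.sub (contDiff_invBracket.continuous.mul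
      ((hV1.continuous_fderiv one_ne_zero).clm_apply continuous_id))
  obtain ⟨A, hA⟩ := (isCompact_closedBall (0 : E d) (max R 1)).exists_bound_of_continuousOn
    hc.continuousOn
  refine ⟨max A 0, max R 1, le_max_right _ _, by positivity, fun x => ?_⟩
  by_cases hx : x ∈ Metric.closedBall (0 : E d) (max R 1)
  · rw [Set.indicator_of_mem hx]
    exact (le_abs_self _).trans ((hA x hx).trans (le_max_left _ _))
  · rw [Set.indicator_of_notMem hx]
    rw [mem_closedBall_zero_iff, not_le, max_lt_iff] at hx
    have h1 := hR x hx.1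
    have h2 := half_le_norm_mul_invBracket hx.2.le
    have hx0 : 0 < ‖x‖ := one_pos.trans hx.2
    rw [radialDeriv, EReal.coe_lt_coe_iff, inner_smul_right, inner_gradient_left,
      inv_mul_eq_div, lt_div_iff₀ hx0] at h1
    have h3 := mul_le_mul_of_nonneg_right h1.le (invBracket_pos x).le
    have h4 : (0 : ℝ) ≤ d + 2 := by positivity
    nlinarith

theorem tendsto_eLpNorm_of_sub {α F : Type*} [MeasurableSpace α] [NormedAddCommGroup F]
    {μ : Measure α} {f : α → F} {g : ℕ → α → F} (hf : AEStronglyMeasurable f μ)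
    (hg : ∀ n, AEStronglyMeasurable (g n) μ)
    (h : Tendsto (fun n => eLpNorm (fun x => f x - g n x) 2 μ) atTop (𝓝 0)) :
    Tendsto (fun n => eLpNorm (g n) 2 μ) atTop (𝓝 (eLpNorm f 2 μ)) := by
  have h1 (n : ℕ) : eLpNorm f 2 μ ≤ eLpNorm (g n) 2 μ + eLpNorm (fun x => f x - g n x) 2 μ := by
    have := eLpNorm_add_le (hg n) (hf.sub (hg n)) (p := 2) (by norm_num)
    rwa [add_sub_cancel] at this
  have h2 (n : ℕ) : eLpNorm (g n) 2 μ ≤ eLpNorm f 2 μ + eLpNorm (fun x => f x - g n x) 2 μ := by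
    have := eLpNorm_sub_le hf (hf.sub (hg n)) (p := 2) (by norm_num)
    rwa [sub_sub_cancel] at this
  refine tendsto_of_tendsto_of_tendsto_of_le_of_le
    (g := fun n => eLpNorm f 2 μ - eLpNorm (fun x => f x - g n x) 2 μ)
    (h := fun n => eLpNorm f 2 μ + eLpNorm (fun x => f x - g n x) 2 μ) ?_ ?_
    (fun n => tsub_le_iff_right.2 (h1 n)) h2
  · simpa using ENNReal.Tendsto.sub tendsto_const_nhds h (Or.inr ENNReal.zero_ne_top)
  · simpa using tendsto_const_nhds.add h

theorem InH1.exists_seq_test (hρ : Continuous ρ) (hpos : ∀ x, 0 < ρ x)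
    {φ : E d → ℝ} {G : E d → E d} (h : InH1 ρ φ G) :
    ∃ ψ : ℕ → E d → ℝ, (∀ n, IsTest (ψ n)) ∧
      Tendsto (fun n => eLpNorm (fun x => φ x - ψ n x) 2 (wMeasure ρ)) atTop (𝓝 0) ∧
      Tendsto (fun n => eLpNorm (fun x => G x - gradient (ψ n) x) 2 (wMeasure ρ)) atTop (𝓝 0) := by
  choose ψ h1 h2 h3 using fun n : ℕ =>
    h.exists_test hρ hpos (ε := ((n : ℝ≥0∞) + 1)⁻¹) (ENNReal.inv_ne_zero.2 (by finiteness))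
  have h0 : Tendsto (fun n : ℕ => ((n : ℝ≥0∞) + 1)⁻¹) atTop (𝓝 0) := by
    have := (tendsto_add_atTop_iff_nat 1).2 ENNReal.tendsto_inv_nat_nhds_zero
    simpa using this
  exact ⟨ψ, h1, tendsto_of_tendsto_of_tendsto_of_le_of_le tendsto_const_nhds h0
    (fun _ => zero_le) h2, tendsto_of_tendsto_of_tendsto_of_le_of_le tendsto_const_nhds h0
    (fun _ => zero_le) h3⟩

theorem eLpNorm_two_sq_eq_ofReal {α F : Type*} [MeasurableSpace α] [NormedAddCommGroup F]
    {μ : Measure α} {f : α → F} (hf : MemLp f 2 μ) :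
    eLpNorm f 2 μ ^ 2 = ENNReal.ofReal (∫ x, ‖f x‖ ^ 2 ∂μ) := by
  rw [eLpNorm_two_sq, ofReal_integral_eq_lintegral_ofReal ((memLp_two_iff_integrable_sq_norm hf.1).1 hf)
    (Eventually.of_forall fun x => by positivity)]
  simp_rw [ENNReal.ofReal_pow (norm_nonneg _), ofReal_norm]

/-- Outside a large ball, the `L²` norm is controlled by the gradient. -/
theorem InH1.eLpNorm_sq_le [IsFiniteMeasure (wMeasure ρ)] {V : E d → ℝ} (hV : ContDiff ℝ 2 V)
    (hρV : ∀ x, ρ x = Real.exp (-V x)) {A R : ℝ} (hA0 : 0 ≤ A)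
    (hA : ∀ x, d + 2 - invBracket x * fderiv ℝ V x x ≤
      (Metric.closedBall (0 : E d) R).indicator (fun _ => A) x)
    {φ : E d → ℝ} {G : E d → E d} (h : InH1 ρ φ G) :
    eLpNorm φ 2 (wMeasure ρ) ^ 2 ≤
      ENNReal.ofReal A * eLpNorm φ 2 ((wMeasure ρ).restrict (Metric.closedBall 0 R)) ^ 2 +
        eLpNorm G 2 (wMeasure ρ) ^ 2 := by
  have hρ : Continuous ρ := by
    rw [show ρ = fun x => Real.exp (-V x) from funext hρV]
    exact Real.continuous_exp.comp hV.continuous.neg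
  have hpos : ∀ x, 0 < ρ x := fun x => by rw [hρV]; positivity
  have htest {f : E d → ℝ} (hf : IsTest f) : eLpNorm f 2 (wMeasure ρ) ^ 2 ≤
      ENNReal.ofReal A * eLpNorm f 2 ((wMeasure ρ).restrict (Metric.closedBall 0 R)) ^ 2 +
        eLpNorm (gradient f) 2 (wMeasure ρ) ^ 2 := by
    have hi := hf.inH1 (ρ := ρ)
    rw [eLpNorm_two_sq_eq_ofReal hi.memLp, eLpNorm_two_sq_eq_ofReal (hi.memLp.restrict _),
      eLpNorm_two_sq_eq_ofReal hi.memLp_grad, ← ENNReal.ofReal_mul hA0,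
      ← ENNReal.ofReal_add (by positivity) (by positivity)]
    refine ENNReal.ofReal_le_ofReal ?_
    simpa using integral_sq_le_of_test hV hρV hA hf
  -- All three norms are continuous under `H¹(ρ)` convergence, so the inequality passes from test
  -- functions to `φ`.
  obtain ⟨ψ, hψ, t1, t2⟩ := h.exists_seq_test hρ hpos
  have hm (n : ℕ) : AEStronglyMeasurable (ψ n) (wMeasure ρ) :=
    (hψ n).continuous.aestronglyMeasurable
  have t1' : Tendsto (fun n => eLpNorm (fun x => φ x - ψ n x) 2
      ((wMeasure ρ).restrict (Metric.closedBall 0 R))) atTop (𝓝 0) :=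
    tendsto_of_tendsto_of_tendsto_of_le_of_le tendsto_const_nhds t1 (fun _ => zero_le)
      fun n => eLpNorm_restrict_le _ _ _ _
  have l1 := tendsto_eLpNorm_of_sub h.memLp.1 hm t1
  have l1' := tendsto_eLpNorm_of_sub h.memLp.1.restrict (fun n => (hm n).restrict) t1'
  have l2 := tendsto_eLpNorm_of_sub h.memLp_grad.1
    (fun n => (hψ n).continuous_gradient.aestronglyMeasurable) t2
  refine le_of_tendsto_of_tendsto' (ENNReal.Tendsto.pow (n := 2) l1)
    ((ENNReal.Tendsto.const_mul (ENNReal.Tendsto.pow (n := 2) l1')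
      (Or.inr ENNReal.ofReal_ne_top)).add (ENNReal.Tendsto.pow (n := 2) l2))
    fun n => htest (hψ n)

/-! ### Poincaré inequality on a ball, for Lebesgue measure. -/

theorem lintegral_comp_smul_add {g : E d → ℝ≥0∞} (hg : Measurable g) {r : ℝ} (hr : r ≠ 0)
    (y : E d) : ∫⁻ x, g (r • x + y) = ENNReal.ofReal |(r ^ d)⁻¹| * ∫⁻ x, g x := by
  have h1 := lintegral_map (μ := (volume : Measure (E d))) (f := fun z => g (z + y))
    (g := fun x => r • x) (by fun_prop) (by fun_prop)
  rw [← h1, Measure.map_addHaar_smul _ hr, lintegral_smul_measure, lintegral_add_right_eq_self,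
    finrank_euclideanSpace_fin, smul_eq_mul]

/-- The fundamental theorem of calculus along the segment from `y` to `x`, followed by Jensen on the
unit interval. -/
theorem enorm_sub_sq_le_lintegral_fderiv {f : E d → ℝ} (hf : ContDiff ℝ 1 f) (x y : E d) :
    ‖f x - f y‖ₑ ^ 2 ≤ ‖x - y‖ₑ ^ 2 *
      ∫⁻ t in Set.Ioc (0 : ℝ) 1, ‖fderiv ℝ f (t • x + (1 - t) • y)‖ₑ ^ 2 := by
  have hprob : IsProbabilityMeasure (volume.restrict (Set.Ioc (0 : ℝ) 1)) := ⟨by simp⟩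
  have hγ (t : ℝ) : HasDerivAt (fun t : ℝ => t • x + (1 - t) • y) (x - y) t := by
    have h := ((hasDerivAt_id t).smul_const x).add
      (((hasDerivAt_const t (1 : ℝ)).sub (hasDerivAt_id t)).smul_const y)
    convert! h using 1
    simp [sub_eq_add_neg]
  have hd (t : ℝ) : HasDerivAt (fun t : ℝ => f (t • x + (1 - t) • y))
      (fderiv ℝ f (t • x + (1 - t) • y) (x - y)) t :=
    (hf.differentiable one_ne_zero _).hasFDerivAt.comp_hasDerivAt t (hγ t)
  have hc : Continuous fun t : ℝ => fderiv ℝ f (t • x + (1 - t) • y) :=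
    (hf.continuous_fderiv one_ne_zero).comp (by fun_prop)
  have hc' : Continuous fun t : ℝ => fderiv ℝ f (t • x + (1 - t) • y) (x - y) :=
    hc.clm_apply continuous_const
  have hftc : f x - f y = ∫ t in Set.Ioc (0 : ℝ) 1, fderiv ℝ f (t • x + (1 - t) • y) (x - y) := by
    rw [← intervalIntegral.integral_of_le zero_le_one,
      intervalIntegral.integral_eq_sub_of_hasDerivAt (fun t _ => hd t)
        (hc'.intervalIntegrable 0 1)]
    simp
  rw [hftc, ← lintegral_const_mul' _ _ (by finiteness)]
  calc _ ≤ (eLpNorm (fun t : ℝ => fderiv ℝ f (t • x + (1 - t) • y) (x - y)) 2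
        (volume.restrict (Set.Ioc (0 : ℝ) 1))) ^ 2 := by
        gcongr
        refine (enorm_integral_le_lintegral_enorm _).trans ?_
        rw [← eLpNorm_one_eq_lintegral_enorm]
        exact eLpNorm_le_eLpNorm_of_exponent_le (by norm_num) hc'.aestronglyMeasurable
    _ = ∫⁻ t in Set.Ioc (0 : ℝ) 1, ‖fderiv ℝ f (t • x + (1 - t) • y) (x - y)‖ₑ ^ 2 :=
        eLpNorm_two_sq _ _
    _ ≤ _ := by
        refine lintegral_mono fun t => ?_
        rw [← mul_pow, mul_comm]
        gcongr
        exact ContinuousLinearMap.le_opENorm _ _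

/-- Convexity keeps the point in `B`, and the substitution `x ↦ t x + (1 - t) y` costs the factor
`t⁻ᵈ ≤ 2ᵈ`. -/
theorem setLIntegral_segment_le {B : Set (E d)} (hB : Convex ℝ B) (hBm : MeasurableSet B)
    {g : E d → ℝ≥0∞} (hg : Measurable g) {y : E d} (hy : y ∈ B) {t : ℝ} (ht : 1 / 2 ≤ t)
    (ht1 : t ≤ 1) : ∫⁻ x in B, g (t • x + (1 - t) • y) ≤ 2 ^ d * ∫⁻ x in B, g x := by
  have ht0 : 0 < t := by linarith
  rw [← lintegral_indicator hBm, ← lintegral_indicator hBm]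
  calc _ ≤ ∫⁻ x, B.indicator g (t • x + (1 - t) • y) := by
        refine lintegral_mono fun x => ?_
        by_cases hx : x ∈ B
        · have hm : t • x + (1 - t) • y ∈ B := hB hx hy ht0.le (by linarith) (by ring)
          simp [hx, hm]
        · simp [hx]
    _ = ENNReal.ofReal |(t ^ d)⁻¹| * ∫⁻ x, B.indicator g x :=
        lintegral_comp_smul_add (hg.indicator hBm) ht0.ne' _
    _ ≤ _ := by
        gcongr
        rw [abs_of_nonneg (by positivity), ← inv_pow, ENNReal.ofReal_pow (by positivity)]
        gcongr
        rw [← ENNReal.ofReal_ofNat 2]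
        refine ENNReal.ofReal_le_ofReal ?_
        rw [inv_le_comm₀ ht0 (by norm_num)]
        linarith

theorem lintegral_lintegral_segment_le {B : Set (E d)} (hB : Convex ℝ B) (hBm : MeasurableSet B)
    {g : E d → ℝ≥0∞} (hg : Measurable g) {t : ℝ} (ht0 : 0 ≤ t) (ht1 : t ≤ 1) :
    ∫⁻ y in B, ∫⁻ x in B, g (t • x + (1 - t) • y) ≤ 2 ^ d * (∫⁻ x in B, g x) * volume B := by
  have hconst (F : E d → ℝ≥0∞) (hF : ∀ y ∈ B, F y ≤ 2 ^ d * ∫⁻ x in B, g x) :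
      ∫⁻ y in B, F y ≤ 2 ^ d * (∫⁻ x in B, g x) * volume B := by
    rw [← setLIntegral_const]
    exact setLIntegral_mono measurable_const hF
  rcases le_total (1 / 2) t with h | h
  · exact hconst _ fun y hy => setLIntegral_segment_le hB hBm hg hy h ht1
  -- For small `t` the Jacobian in `x` degenerates, so `y` is used as the inner variable: its
  -- coefficient `1 - t` is at least `1/2`.
  · rw [lintegral_lintegral_swap (by fun_prop)]
    refine hconst _ fun x hx => ?_
    have := setLIntegral_segment_le hB hBm hg hx (t := 1 - t) (by linarith) (by linarith)
    simpa [add_comm] using this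

/-- Poincaré inequality on a ball. -/
theorem exists_lintegral_ball_sub_const_le {R : ℝ} (hR : 0 < R) {f : E d → ℝ}
    (hf : ContDiff ℝ 1 f) : ∃ c : ℝ, ∫⁻ x in Metric.closedBall (0 : E d) R, ‖f x - c‖ₑ ^ 2 ≤
      ENNReal.ofReal (2 * R) ^ 2 * 2 ^ d *
        ∫⁻ x in Metric.closedBall (0 : E d) R, ‖fderiv ℝ f x‖ₑ ^ 2 := by
  set B := Metric.closedBall (0 : E d) R with hBdef
  have hBm : MeasurableSet B := measurableSet_closedBall
  have hB0 : volume B ≠ 0 := (Metric.measure_closedBall_pos volume _ hR).ne'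
  have hBt : volume B ≠ ⊤ := (isCompact_closedBall (0 : E d) R).measure_lt_top.ne
  have hfc := hf.continuous
  have hDc := hf.continuous_fderiv one_ne_zero
  set g : E d → ℝ≥0∞ := fun x => ‖fderiv ℝ f x‖ₑ ^ 2 with hg
  have hgm : Measurable g := by
    have : Continuous g := by fun_prop
    exact this.measurable
  set D := ∫⁻ x in B, g x with hD
  have hmain : ∫⁻ y in B, ∫⁻ x in B, ‖f x - f y‖ₑ ^ 2 ≤
      ENNReal.ofReal (2 * R) ^ 2 * (2 ^ d * D * volume B) := by
    calc ∫⁻ y in B, ∫⁻ x in B, ‖f x - f y‖ₑ ^ 2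
        ≤ ∫⁻ y in B, ∫⁻ x in B, ENNReal.ofReal (2 * R) ^ 2 *
          ∫⁻ t in Set.Ioc (0 : ℝ) 1, g (t • x + (1 - t) • y) := by
          refine setLIntegral_mono' hBm fun y hy => setLIntegral_mono' hBm fun x hx => ?_
          refine (enorm_sub_sq_le_lintegral_fderiv hf x y).trans ?_
          gcongr
          rw [← ofReal_norm]
          refine ENNReal.ofReal_le_ofReal ((norm_sub_le _ _).trans ?_)
          rw [hBdef, mem_closedBall_zero_iff] at hx hy
          linarith
      _ = ENNReal.ofReal (2 * R) ^ 2 * ∫⁻ y in B, ∫⁻ x in B,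
          ∫⁻ t in Set.Ioc (0 : ℝ) 1, g (t • x + (1 - t) • y) := by
          rw [← lintegral_const_mul' _ _ (by finiteness)]
          congr 1
          ext1 y
          rw [lintegral_const_mul' _ _ (by finiteness)]
      _ = ENNReal.ofReal (2 * R) ^ 2 * ∫⁻ t in Set.Ioc (0 : ℝ) 1, ∫⁻ y in B, ∫⁻ x in B,
          g (t • x + (1 - t) • y) := by
          congr 1
          calc ∫⁻ y in B, ∫⁻ x in B, ∫⁻ t in Set.Ioc (0 : ℝ) 1, g (t • x + (1 - t) • y)
              = ∫⁻ y in B, ∫⁻ t in Set.Ioc (0 : ℝ) 1, ∫⁻ x in B, g (t • x + (1 - t) • y) := by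
                refine lintegral_congr fun y => lintegral_lintegral_swap ?_
                exact (hgm.comp (by fun_prop :
                  Measurable fun q : E d × ℝ => q.2 • q.1 + (1 - q.2) • y)).aemeasurable
            _ = _ := by
                refine lintegral_lintegral_swap ?_
                have h3 : Measurable fun p : (E d × ℝ) × E d =>
                    g (p.1.2 • p.2 + (1 - p.1.2) • p.1.1) := hgm.comp (by fun_prop)
                exact (h3.lintegral_prod_right' (ν := volume.restrict B)).aemeasurable
      _ ≤ ENNReal.ofReal (2 * R) ^ 2 * ∫⁻ t in Set.Ioc (0 : ℝ) 1, 2 ^ d * D * volume B := by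
          gcongr 1
          refine setLIntegral_mono' measurableSet_Ioc fun t ht => ?_
          exact lintegral_lintegral_segment_le (convex_closedBall 0 R) hBm hgm ht.1.le ht.2
      _ = _ := by simp
  have hmeas : AEMeasurable (fun y => ∫⁻ x in B, ‖f x - f y‖ₑ ^ 2) (volume.restrict B) := by
    have h2 : Continuous fun p : E d × E d => ‖f p.2 - f p.1‖ₑ ^ 2 := by fun_prop
    exact (h2.measurable.lintegral_prod_right' (ν := volume.restrict B)).aemeasurable
  -- Some `y` does no worse than the average of the double integral, and `f y` serves as the
  -- constant; it need not be the mean.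
  obtain ⟨y, -, hy⟩ := exists_le_setLAverage hB0 hBt hmeas
  refine ⟨f y, hy.trans ?_⟩
  rw [setLAverage_eq]
  refine (ENNReal.div_le_of_le_mul' ?_)
  refine hmain.trans (le_of_eq ?_)
  ring

/-! ### Weighted Poincaré inequality. -/

theorem enorm_gradient (f : E d → ℝ) (x : E d) : ‖gradient f x‖ₑ = ‖fderiv ℝ f x‖ₑ := by
  rw [← ofReal_norm, norm_gradient, ofReal_norm]

theorem eLpNorm_const_two {μ : Measure (E d)} [IsProbabilityMeasure μ] (c : ℝ) :
    eLpNorm (fun _ => c) 2 μ = ‖c‖ₑ := by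
  rw [eLpNorm_const _ (by norm_num) (NeZero.ne μ)]
  simp

theorem enorm_integral_le_eLpNorm_two {μ : Measure (E d)} [IsProbabilityMeasure μ] {f : E d → ℝ}
    (hf : AEStronglyMeasurable f μ) : ‖∫ x, f x ∂μ‖ₑ ≤ eLpNorm f 2 μ := by
  refine (enorm_integral_le_lintegral_enorm _).trans ?_
  rw [← eLpNorm_one_eq_lintegral_enorm]
  exact eLpNorm_le_eLpNorm_of_exponent_le (by norm_num) hf

/-- Weighted Poincaré inequality. -/
theorem AssumptionA1.exists_poincare (h : AssumptionA1 ρ) :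
    ∃ K : ℝ≥0∞, K ≠ ⊤ ∧ ∀ φ G, InH1 ρ φ G →
      eLpNorm φ 2 (wMeasure ρ) ≤ K * eLpNorm G 2 (wMeasure ρ) + ‖mean ρ φ‖ₑ := by
  obtain ⟨hden, V, hρV, ⟨hV, -⟩, hlim⟩ := h
  have hprob := hden.isProbabilityMeasure
  have hρ : Continuous ρ := by
    rw [show ρ = fun x => Real.exp (-V x) from funext hρV]
    exact Real.continuous_exp.comp hV.continuous.neg
  have hpos : ∀ x, 0 < ρ x := fun x => by rw [hρV]; positivity
  obtain ⟨A, R, hA0, hR, hA⟩ := exists_radial_bound hV hlim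
  have hK := isCompact_closedBall (0 : E d) R
  obtain ⟨c₁, -, hc₁, hle₁⟩ := exists_wMeasure_restrict_le hρ hK
  obtain ⟨c₂, -, hc₂, hle₂⟩ := exists_volume_restrict_le hρ hpos hK
  -- The product collects the Lyapunov constant, the ball constant `(2R)² 2ᵈ` and the two changes of
  -- measure. The summand 1 is the gradient term of the Lyapunov estimate; it also gives `L ≤ L²`,
  -- so no square root is needed.
  set L : ℝ≥0∞ := ENNReal.ofReal A * (c₁ * (ENNReal.ofReal (2 * R) ^ 2 * 2 ^ d * c₂)) + 1 with hL
  have hLt : L ≠ ⊤ := by finiteness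
  have htest {f : E d → ℝ} (hf : IsTest f) : eLpNorm f 2 (wMeasure ρ) ≤
      2 * L * eLpNorm (gradient f) 2 (wMeasure ρ) + ‖mean ρ f‖ₑ := by
    obtain ⟨c, hc⟩ := exists_lintegral_ball_sub_const_le hR hf.contDiff_one
    have hfc := hf.inH1.sub (inH1_const (ρ := ρ) c)
    have h1 := hfc.eLpNorm_sq_le hV hρV hA0 hA
    simp only [sub_zero] at h1
    have h2 : eLpNorm (fun x => f x - c) 2 ((wMeasure ρ).restrict (Metric.closedBall 0 R)) ^ 2 ≤
        c₁ * (ENNReal.ofReal (2 * R) ^ 2 * 2 ^ d *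
          (c₂ * eLpNorm (gradient f) 2 (wMeasure ρ) ^ 2)) := by
      rw [eLpNorm_two_sq, eLpNorm_two_sq]
      calc _ ≤ c₁ * ∫⁻ x in Metric.closedBall (0 : E d) R, ‖f x - c‖ₑ ^ 2 := by
            rw [← smul_eq_mul, ← lintegral_smul_measure]
            exact lintegral_mono' hle₁ le_rfl
        _ ≤ _ := by
            gcongr
            refine hc.trans ?_
            gcongr
            simp_rw [← enorm_gradient]
            rw [← smul_eq_mul, ← lintegral_smul_measure]
            exact lintegral_mono' hle₂ le_rfl
    have h3 : eLpNorm (fun x => f x - c) 2 (wMeasure ρ) ^ 2 ≤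
        (L * eLpNorm (gradient f) 2 (wMeasure ρ)) ^ 2 := by
      have hL1 : 1 ≤ L := by rw [hL]; exact le_add_self
      calc _ ≤ L * eLpNorm (gradient f) 2 (wMeasure ρ) ^ 2 := by
            refine (h1.trans (add_le_add (mul_le_mul' le_rfl h2) le_rfl)).trans (le_of_eq ?_)
            rw [hL]
            ring
        _ ≤ L ^ 2 * eLpNorm (gradient f) 2 (wMeasure ρ) ^ 2 := by
            gcongr
            exact le_self_pow₀ hL1 two_ne_zero
        _ = _ := (mul_pow _ _ _).symm
    rw [ENNReal.pow_le_pow_left_iff two_ne_zero] at h3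
    have hi : Integrable f (wMeasure ρ) := hf.inH1.memLp.integrable (by norm_num)
    -- The constant coming from the ball is not the `ρ`-mean. Replacing it costs a second copy of
    -- the bound on `f - c`, hence the final factor `2 * L`.
    have h4 : ‖mean ρ f - c‖ₑ ≤ eLpNorm (fun x => f x - c) 2 (wMeasure ρ) := by
      have := enorm_integral_le_eLpNorm_two hfc.memLp.1
      rw [integral_sub hi (integrable_const c)] at this
      simpa [mean] using this
    have h5 : eLpNorm f 2 (wMeasure ρ) ≤ eLpNorm (fun x => f x - c) 2 (wMeasure ρ) + ‖c‖ₑ := by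
      rw [← eLpNorm_const_two (μ := wMeasure ρ) c]
      have := eLpNorm_add_le hfc.memLp.1 (aestronglyMeasurable_const (b := c)) (p := 2)
        (by norm_num)
      simpa [Pi.add_def] using this
    have h6 : ‖c‖ₑ ≤ eLpNorm (fun x => f x - c) 2 (wMeasure ρ) + ‖mean ρ f‖ₑ := by
      have : c = mean ρ f - (mean ρ f - c) := by ring
      calc ‖c‖ₑ = ‖mean ρ f - (mean ρ f - c)‖ₑ := by rw [← this]
        _ ≤ ‖mean ρ f‖ₑ + ‖mean ρ f - c‖ₑ := enorm_sub_le
        _ ≤ _ := by rw [add_comm]; gcongr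
    calc _ ≤ _ := h5
      _ ≤ _ := add_le_add_right h6 _
      _ ≤ L * eLpNorm (gradient f) 2 (wMeasure ρ) +
          (L * eLpNorm (gradient f) 2 (wMeasure ρ) + ‖mean ρ f‖ₑ) := by gcongr
      _ = _ := by ring
  refine ⟨2 * L, by finiteness, fun φ G hφ => ?_⟩
  obtain ⟨ψ, hψ, t1, t2⟩ := hφ.exists_seq_test hρ hpos
  have hm (n : ℕ) : AEStronglyMeasurable (ψ n) (wMeasure ρ) :=
    (hψ n).continuous.aestronglyMeasurable
  have l1 := tendsto_eLpNorm_of_sub hφ.memLp.1 hm t1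
  have l2 := tendsto_eLpNorm_of_sub hφ.memLp_grad.1
    (fun n => (hψ n).continuous_gradient.aestronglyMeasurable) t2
  have l3 : Tendsto (fun n => mean ρ (ψ n)) atTop (𝓝 (mean ρ φ)) := by
    rw [tendsto_iff_edist_tendsto_0]
    refine tendsto_of_tendsto_of_tendsto_of_le_of_le tendsto_const_nhds t1
      (fun _ => zero_le) fun n => ?_
    simp only
    rw [edist_comm, edist_eq_enorm_sub, mean, mean,
      ← integral_sub (hφ.memLp.integrable (by norm_num))
        ((hψ n).inH1.memLp.integrable (by norm_num))]
    exact enorm_integral_le_eLpNorm_two (hφ.memLp.1.sub (hm n))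
  exact le_of_tendsto_of_tendsto' l1 ((ENNReal.Tendsto.const_mul l2 (Or.inr (by finiteness))).add
    l3.enorm) fun n => htest (hψ n)

/-! ### `H¹(ρ)` as a Hilbert space, and Lax–Milgram. -/

theorem HasWeakGradient.congr {φ φ' : E d → ℝ} {G G' : E d → E d} (h : HasWeakGradient φ G)
    (hφ : φ =ᵐ[volume] φ') (hG : G =ᵐ[volume] G') : HasWeakGradient φ' G' where
  locallyIntegrable := h.1.congr hφ
  locallyIntegrable_grad := h.2.congr hG
  integral_eq ψ hψ e := by
    rw [integral_congr_ae (g := fun x => φ x * fderiv ℝ ψ x e), h.3 ψ hψ e,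
      integral_congr_ae (g := fun x => inner ℝ (G' x) e * ψ x)]
    · filter_upwards [hG] with x hx
      rw [hx]
    · filter_upwards [hφ] with x hx
      rw [hx]

theorem InH1.congr (hρ : Continuous ρ) (hpos : ∀ x, 0 < ρ x)
    {φ φ' : E d → ℝ} {G G' : E d → E d} (h : InH1 ρ φ G)
    (hφ : φ =ᵐ[wMeasure ρ] φ') (hG : G =ᵐ[wMeasure ρ] G') : InH1 ρ φ' G' where
  memLp := h.memLp.ae_eq hφ
  hasWeakGradient := h.hasWeakGradient.congr
    ((volume_absolutelyContinuous_wMeasure hρ hpos).ae_eq hφ)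
    ((volume_absolutelyContinuous_wMeasure hρ hpos).ae_eq hG)
  memLp_grad := h.memLp_grad.ae_eq hG

/-- The Hilbert space `L²(ρ) × L²(ρ; ℝ^d)`. -/
abbrev L2Pair {d : ℕ} (ρ : E d → ℝ) :=
  WithLp 2 (Lp ℝ 2 (wMeasure ρ) × Lp (E d) 2 (wMeasure ρ))

/-- Weak gradients are defined by Lebesgue integrals. Dividing a test function by `ρ` turns such an
integral into an inner product in `L²(ρ)`. -/
theorem continuous_memLp_div [IsFiniteMeasure (wMeasure ρ)] (hρ : Continuous ρ)
    (hpos : ∀ x, 0 < ρ x) {F : Type*} [NormedAddCommGroup F] [NormedSpace ℝ F] {f : E d → F}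
    (hf : Continuous f) (hf' : HasCompactSupport f) :
    MemLp (fun x => (ρ x)⁻¹ • f x) 2 (wMeasure ρ) :=
  continuous_memLp_of_hasCompactSupport ((hρ.inv₀ fun x => (hpos x).ne').smul hf) hf'.smul_left

/-- The weak gradient equation against a fixed test function, as orthogonality in `L²(ρ)`. -/
theorem hasWeakGradient_iff_inner [IsFiniteMeasure (wMeasure ρ)] (hρ : Continuous ρ)
    (hpos : ∀ x, 0 < ρ x) {ψ : E d → ℝ} (hψ : IsTest ψ) (e : E d) (p : L2Pair ρ) :
    (∫ x, p.fst x * fderiv ℝ ψ x e = -∫ x, inner ℝ (p.snd x) e * ψ x) ↔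
      inner ℝ ((continuous_memLp_div hρ hpos (hψ.continuous_fderiv_apply e)
        (hψ.2.fderiv_apply (𝕜 := ℝ) e)).toLp _) p.fst +
      inner ℝ ((continuous_memLp_div hρ hpos (hψ.continuous.smul continuous_const)
        (hψ.2.smul_right (f' := fun _ => e))).toLp _) p.snd = 0 := by
  rw [L2.inner_def, L2.inner_def]
  have e1 : ∫ x, p.fst x * fderiv ℝ ψ x e = ∫ x, inner ℝ
      ((continuous_memLp_div hρ hpos (hψ.continuous_fderiv_apply e)
        (hψ.2.fderiv_apply (𝕜 := ℝ) e)).toLp _ x) (p.fst x) ∂(wMeasure ρ) := by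
    have := integral_congr_ae (μ := wMeasure ρ)
      (f := fun x => inner ℝ ((continuous_memLp_div hρ hpos (hψ.continuous_fderiv_apply e)
        (hψ.2.fderiv_apply (𝕜 := ℝ) e)).toLp _ x) (p.fst x))
      (g := fun x => inner ℝ ((ρ x)⁻¹ • fderiv ℝ ψ x e) (p.fst x)) (by
        filter_upwards [(continuous_memLp_div hρ hpos (hψ.continuous_fderiv_apply e)
          (hψ.2.fderiv_apply (𝕜 := ℝ) e)).coeFn_toLp] with x hx
        rw [hx])
    rw [this, integral_wMeasure hρ hpos]
    congr 1
    ext1 x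
    have := (hpos x).ne'
    simp only [smul_eq_mul, RCLike.inner_apply, conj_trivial]
    field_simp
  have e2 : ∫ x, inner ℝ (p.snd x) e * ψ x = ∫ x, inner ℝ
      ((continuous_memLp_div hρ hpos (hψ.continuous.smul continuous_const)
        (hψ.2.smul_right (f' := fun _ => e))).toLp _ x) (p.snd x) ∂(wMeasure ρ) := by
    have := integral_congr_ae (μ := wMeasure ρ)
      (f := fun x => inner ℝ ((continuous_memLp_div hρ hpos (hψ.continuous.smul continuous_const)
        (hψ.2.smul_right (f' := fun _ => e))).toLp _ x) (p.snd x))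
      (g := fun x => inner ℝ ((ρ x)⁻¹ • (ψ x • e)) (p.snd x)) (by
        filter_upwards [(continuous_memLp_div hρ hpos (hψ.continuous.smul continuous_const)
          (hψ.2.smul_right (f' := fun _ => e))).coeFn_toLp] with x hx
        rw [hx]
        rfl)
    rw [this, integral_wMeasure hρ hpos]
    congr 1
    ext1 x
    have := (hpos x).ne'
    rw [real_inner_smul_left, real_inner_smul_left, real_inner_comm]
    simp only [smul_eq_mul]
    field_simp
  rw [e1, e2]
  constructor <;> intro h <;> linarith

/-- `H¹(ℝ^d; ρ)` as a closed subspace of `L²(ρ) × L²(ρ; ℝ^d)`. -/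
def sobolev [IsFiniteMeasure (wMeasure ρ)] (hρ : Continuous ρ) (hpos : ∀ x, 0 < ρ x) :
    Submodule ℝ (L2Pair ρ) where
  carrier := {p | ∀ (ψ : E d → ℝ) (hψ : IsTest ψ) (e : E d),
      inner ℝ ((continuous_memLp_div hρ hpos (hψ.continuous_fderiv_apply e)
        (hψ.2.fderiv_apply (𝕜 := ℝ) e)).toLp _) p.fst +
      inner ℝ ((continuous_memLp_div hρ hpos (hψ.continuous.smul continuous_const)
        (hψ.2.smul_right (f' := fun _ => e))).toLp _) p.snd = 0}
  add_mem' {p q} hp hq ψ hψ e := by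
    have h1 := hp ψ hψ e
    have h2 := hq ψ hψ e
    rw [WithLp.add_fst, WithLp.add_snd, inner_add_right, inner_add_right]
    linarith
  zero_mem' ψ hψ e := by
    rw [WithLp.zero_fst, WithLp.zero_snd, inner_zero_right, inner_zero_right, add_zero]
  smul_mem' c p hp ψ hψ e := by
    have h1 := hp ψ hψ e
    rw [WithLp.smul_fst, WithLp.smul_snd, real_inner_smul_right, real_inner_smul_right, ← mul_add,
      h1, mul_zero]

theorem mem_sobolev_iff [IsFiniteMeasure (wMeasure ρ)] (hρ : Continuous ρ) (hpos : ∀ x, 0 < ρ x)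
    {p : L2Pair ρ} : p ∈ sobolev hρ hpos ↔ InH1 ρ p.fst p.snd := by
  refine ⟨fun h => ⟨Lp.memLp _, ⟨locallyIntegrable_of_memLp hρ hpos (Lp.memLp _),
    locallyIntegrable_of_memLp hρ hpos (Lp.memLp _), fun ψ hψ e => ?_⟩, Lp.memLp _⟩,
    fun h ψ hψ e => ?_⟩
  · exact (hasWeakGradient_iff_inner hρ hpos hψ e p).2 (h ψ hψ e)
  · exact (hasWeakGradient_iff_inner hρ hpos hψ e p).1 (h.2.3 ψ hψ e)

theorem isClosed_sobolev [IsFiniteMeasure (wMeasure ρ)] (hρ : Continuous ρ)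
    (hpos : ∀ x, 0 < ρ x) : IsClosed (sobolev hρ hpos : Set (L2Pair ρ)) := by
  have : (sobolev hρ hpos : Set (L2Pair ρ)) = ⋂ (ψ : E d → ℝ) (hψ : IsTest ψ) (e : E d),
      {p : L2Pair ρ | inner ℝ ((continuous_memLp_div hρ hpos (hψ.continuous_fderiv_apply e)
        (hψ.2.fderiv_apply (𝕜 := ℝ) e)).toLp _) p.fst +
      inner ℝ ((continuous_memLp_div hρ hpos (hψ.continuous.smul continuous_const)
        (hψ.2.smul_right (f' := fun _ => e))).toLp _) p.snd = 0} := by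
    ext p
    simp only [Set.mem_iInter]
    rfl
  rw [this]
  refine isClosed_iInter fun ψ => isClosed_iInter fun hψ => isClosed_iInter fun e => ?_
  have c1 : Continuous fun p : L2Pair ρ => p.fst := (WithLp.fstL 2 ℝ _ _).continuous
  have c2 : Continuous fun p : L2Pair ρ => p.snd := (WithLp.sndL 2 ℝ _ _).continuous
  exact isClosed_eq ((continuous_const.inner c1).add (continuous_const.inner c2)) continuous_const

theorem inner_toLp_eq_integral {F : Type*} [NormedAddCommGroup F] [InnerProductSpace ℝ F]
    {μ : Measure (E d)} {f g : E d → F} (hf : MemLp f 2 μ) (hg : MemLp g 2 μ) :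
    inner ℝ (hf.toLp f) (hg.toLp g) = ∫ x, inner ℝ (f x) (g x) ∂μ := by
  rw [L2.inner_def]
  refine integral_congr_ae ?_
  filter_upwards [hf.coeFn_toLp, hg.coeFn_toLp] with x h1 h2
  rw [h1, h2]

theorem integrable_inner_of_memLp {F : Type*} [NormedAddCommGroup F] [InnerProductSpace ℝ F]
    {μ : Measure (E d)} {f g : E d → F} (hf : MemLp f 2 μ) (hg : MemLp g 2 μ) :
    Integrable (fun x => inner ℝ (f x) (g x)) μ := by
  refine (L2.integrable_inner (𝕜 := ℝ) (hf.toLp f) (hg.toLp g)).congr ?_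
  filter_upwards [hf.coeFn_toLp, hg.coeFn_toLp] with x h1 h2
  rw [h1, h2]

/-- Solvability of the Poisson equation, from the Poincaré inequality and Lax–Milgram. -/
theorem exists_weak_solution [IsProbabilityMeasure (wMeasure ρ)] (hρ : Continuous ρ)
    (hpos : ∀ x, 0 < ρ x) {K : ℝ≥0∞} (hK : K ≠ ⊤)
    (hpoinc : ∀ φ G, InH1 ρ φ G →
      eLpNorm φ 2 (wMeasure ρ) ≤ K * eLpNorm G 2 (wMeasure ρ) + ‖mean ρ φ‖ₑ)
    {f : E d → ℝ} (hf : MemLp f 2 (wMeasure ρ)) (hf0 : ∫ x, f x ∂(wMeasure ρ) = 0) :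
    ∃ φ G, InH1 ρ φ G ∧ mean ρ φ = 0 ∧ ∀ (ψ : E d → ℝ) (Ψ : E d → E d), InH1 ρ ψ Ψ →
      ∫ x, inner ℝ (G x) (Ψ x) ∂(wMeasure ρ) = ∫ x, f x * ψ x ∂(wMeasure ρ) := by
  set W := sobolev hρ hpos with hW
  have hWc : CompleteSpace W := (isClosed_sobolev hρ hpos).completeSpace_coe
  let π₁ : W →L[ℝ] Lp ℝ 2 (wMeasure ρ) := (WithLp.fstL 2 ℝ _ _).comp W.subtypeL
  let π₂ : W →L[ℝ] Lp (E d) 2 (wMeasure ρ) := (WithLp.sndL 2 ℝ _ _).comp W.subtypeL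
  have hone : MemLp (fun _ : E d => (1 : ℝ)) 2 (wMeasure ρ) := memLp_const 1
  let m : W →L[ℝ] ℝ := (innerSL ℝ (hone.toLp _)).comp π₁
  let ℓ : W →L[ℝ] ℝ := (innerSL ℝ (hf.toLp _)).comp π₁
  -- The rank-one term makes the form coercive on all of `H¹(ρ)`, constants included, so there is no
  -- need to restrict to mean-zero functions.
  let B : W →L[ℝ] W →L[ℝ] ℝ := (isBoundedBilinearMap_inner (𝕜 := ℝ)).toContinuousLinearMap.bilinearComp π₂ π₂ +
    m.smulRight m
  have hB (p q : W) : B p q = inner ℝ (π₂ p) (π₂ q) + m p * m q := rfl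
  have hm (p : W) : m p = mean ρ (π₁ p) := by
    have h1 : m p = inner ℝ (hone.toLp _) (π₁ p) := rfl
    rw [h1, L2.inner_def, mean]
    refine integral_congr_ae ?_
    filter_upwards [hone.coeFn_toLp] with x hx
    rw [hx]
    simp
  have hH1 (p : W) : InH1 ρ (π₁ p) (π₂ p) := (mem_sobolev_iff hρ hpos).1 p.2
  have hnorm (p : W) : ‖π₁ p‖ ≤ K.toReal * ‖π₂ p‖ + |m p| := by
    have h1 := hpoinc _ _ (hH1 p)
    have h2 := ENNReal.toReal_mono (by
      have := (hH1 p).memLp_grad.eLpNorm_ne_top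
      finiteness) h1
    rw [ENNReal.toReal_add (ENNReal.mul_ne_top hK (hH1 p).memLp_grad.eLpNorm_ne_top)
      (by finiteness), ENNReal.toReal_mul, toReal_enorm, ← hm, Real.norm_eq_abs] at h2
    exact h2
  have hcoer : IsCoercive B := by
    -- By Poincaré and `(a + b)² ≤ 2a² + 2b²`, `‖p‖² ≤ (2K² + 1) ‖π₂ p‖² + 2 (m p)²`.
    refine ⟨1 / (2 * K.toReal ^ 2 + 2), by positivity, fun p => ?_⟩
    have h1 := hnorm p
    have h2 : ‖p‖ ^ 2 = ‖π₁ p‖ ^ 2 + ‖π₂ p‖ ^ 2 := WithLp.prod_norm_sq_eq_of_L2 (p : L2Pair ρ)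
    have h3 : ‖π₁ p‖ ^ 2 ≤ (K.toReal * ‖π₂ p‖ + |m p|) ^ 2 := by gcongr
    rw [hB, real_inner_self_eq_norm_sq, mul_assoc, ← sq, h2, one_div, inv_mul_le_iff₀ (by positivity)]
    nlinarith [sq_nonneg (K.toReal * ‖π₂ p‖ - |m p|), sq_abs (m p),
      mul_nonneg (sq_nonneg K.toReal) (sq_nonneg (m p)), sq_nonneg (m p), sq_nonneg ‖π₂ p‖]
  obtain ⟨v, hv⟩ : ∃ v : W, ∀ w, B v w = ℓ w := by
    refine ⟨hcoer.continuousLinearEquivOfBilin.symm ((InnerProductSpace.toDual ℝ W).symm ℓ),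
      fun w => ?_⟩
    rw [← hcoer.continuousLinearEquivOfBilin_apply, ContinuousLinearEquiv.apply_symm_apply,
      InnerProductSpace.toDual_symm_apply]
  have hlift (ψ : E d → ℝ) (Ψ : E d → E d) (h : InH1 ρ ψ Ψ) :
      WithLp.toLp 2 (h.memLp.toLp ψ, h.memLp_grad.toLp Ψ) ∈ W := by
    rw [hW, mem_sobolev_iff]
    exact h.congr hρ hpos h.memLp.coeFn_toLp.symm h.memLp_grad.coeFn_toLp.symm
  have hℓ (ψ : E d → ℝ) (Ψ : E d → E d) (h : InH1 ρ ψ Ψ) :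
      ℓ ⟨_, hlift ψ Ψ h⟩ = ∫ x, f x * ψ x ∂(wMeasure ρ) := by
    have h1 : ℓ ⟨_, hlift ψ Ψ h⟩ = inner ℝ (hf.toLp _) (h.memLp.toLp ψ) := rfl
    rw [h1, inner_toLp_eq_integral]
    simp [mul_comm]
  -- Testing with the constant 1 leaves `m v = ∫ f ρ = 0`. The rank-one term then disappears and the
  -- original weak equation remains.
  have hmean : m v = 0 := by
    have h1 := hv ⟨_, hlift _ _ (inH1_const 1)⟩
    rw [hℓ _ _ (inH1_const (ρ := ρ) 1), hB, hm ⟨_, hlift _ _ (inH1_const 1)⟩] at h1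
    have h2 : mean ρ (π₁ ⟨_, hlift _ _ (inH1_const (ρ := ρ) 1)⟩) = 1 := by
      have : mean ρ (π₁ ⟨_, hlift _ _ (inH1_const (ρ := ρ) 1)⟩) =
          ∫ _, (1 : ℝ) ∂(wMeasure ρ) :=
        integral_congr_ae (inH1_const (ρ := ρ) 1).memLp.coeFn_toLp
      rw [this]
      simp
    have h3 : π₂ ⟨_, hlift _ _ (inH1_const (ρ := ρ) 1)⟩ = 0 :=
      MemLp.toLp_zero (inH1_const (ρ := ρ) 1).memLp_grad
    rw [h2, h3, inner_zero_right] at h1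
    simpa [hf0] using h1
  refine ⟨π₁ v, π₂ v, hH1 v, by rw [← hm, hmean], fun ψ Ψ h => ?_⟩
  have h1 := hv ⟨_, hlift ψ Ψ h⟩
  rw [hℓ ψ Ψ h, hB, hmean, zero_mul, add_zero] at h1
  rw [← h1]
  have h2 : inner ℝ (π₂ v) (π₂ ⟨_, hlift ψ Ψ h⟩) = inner ℝ (π₂ v) (h.memLp_grad.toLp Ψ) := rfl
  rw [h2, L2.inner_def]
  refine integral_congr_ae ?_
  filter_upwards [h.memLp_grad.coeFn_toLp] with x hx
  rw [hx]

/-! ### Orthogonality of gradients and divergence-free fields, and Pythagoras. -/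

/-- Gradients are orthogonal to square-integrable divergence-free fields. -/
theorem InH1.integral_inner_divFree [IsFiniteMeasure (wMeasure ρ)] (hρ : Continuous ρ)
    (hpos : ∀ x, 0 < ρ x) {φ : E d → ℝ} {G v : E d → E d} (h : InH1 ρ φ G) (hv : DivFree ρ v)
    (hv2 : MemLp v 2 (wMeasure ρ)) : ∫ x, inner ℝ (G x) (v x) ∂(wMeasure ρ) = 0 := by
  obtain ⟨ψ, hψ, -, t⟩ := h.exists_seq_test hρ hpos
  -- Since `v` annihilates `∇ψₙ`, `G` may be replaced by `G - ∇ψₙ`, and Cauchy–Schwarz applies.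
  have hbound (n : ℕ) : ‖∫ x, inner ℝ (G x) (v x) ∂(wMeasure ρ)‖ ≤
      (eLpNorm (fun x => G x - gradient (ψ n) x) 2 (wMeasure ρ)).toReal * ‖hv2.toLp v‖ := by
    have hg := (hψ n).inH1 (ρ := ρ)
    have h0 := hv.weak_eq _ (hψ n)
    simp only [zero_mul, integral_zero, neg_zero] at h0
    have h0' : ∫ x, inner ℝ (gradient (ψ n) x) (v x) ∂(wMeasure ρ) = 0 := by
      rw [← h0]
      exact integral_congr_ae (Eventually.of_forall fun x => real_inner_comm _ _)
    have hd := h.memLp_grad.sub hg.memLp_grad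
    have h1 : ∫ x, inner ℝ (G x) (v x) ∂(wMeasure ρ) = inner ℝ (hd.toLp _) (hv2.toLp v) := by
      rw [inner_toLp_eq_integral]
      simp only [Pi.sub_apply, inner_sub_left]
      rw [integral_sub (integrable_inner_of_memLp h.memLp_grad hv2)
        (integrable_inner_of_memLp hg.memLp_grad hv2), h0', sub_zero]
    rw [h1]
    refine (norm_inner_le_norm _ _).trans (le_of_eq ?_)
    rw [Lp.norm_toLp]
    rfl
  have hlim : Tendsto (fun n => (eLpNorm (fun x => G x - gradient (ψ n) x) 2
      (wMeasure ρ)).toReal * ‖hv2.toLp v‖) atTop (𝓝 0) := by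
    have := ((ENNReal.tendsto_toReal ENNReal.zero_ne_top).comp t).mul_const ‖hv2.toLp v‖
    simpa using this
  have := ge_of_tendsto' hlim hbound
  exact norm_le_zero_iff.1 this

theorem SolvesDiv.integrable_left {f : E d → ℝ} {u : E d → E d} (h : SolvesDiv ρ f u)
    {ψ : E d → ℝ} (hψ : IsTest ψ) :
    Integrable (fun x => inner ℝ (u x) (gradient ψ x)) (wMeasure ρ) :=
  integrable_inner_of_hasCompactSupport h.1 hψ.continuous_gradient
    (hasCompactSupport_gradient hψ.2)

theorem SolvesDiv.integrable_right {f : E d → ℝ} {u : E d → E d} (h : SolvesDiv ρ f u)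
    {ψ : E d → ℝ} (hψ : IsTest ψ) : Integrable (fun x => f x * ψ x) (wMeasure ρ) :=
  integrable_mul_of_hasCompactSupport h.2 hψ.continuous hψ.2

theorem SolvesDiv.add {f g : E d → ℝ} {u v : E d → E d} (hu : SolvesDiv ρ f u)
    (hv : SolvesDiv ρ g v) : SolvesDiv ρ (fun x => f x + g x) (fun x => u x + v x) where
  locallyIntegrable := hu.1.add hv.1
  locallyIntegrable_rhs := hu.2.add hv.2
  weak_eq ψ hψ := by
    simp_rw [inner_add_left, add_mul]
    rw [integral_add (hu.integrable_left hψ) (hv.integrable_left hψ),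
      integral_add (hu.integrable_right hψ) (hv.integrable_right hψ), hu.3 ψ hψ, hv.3 ψ hψ]
    ring

theorem SolvesDiv.sub {f g : E d → ℝ} {u v : E d → E d} (hu : SolvesDiv ρ f u)
    (hv : SolvesDiv ρ g v) : SolvesDiv ρ (fun x => f x - g x) (fun x => u x - v x) where
  locallyIntegrable := hu.1.sub hv.1
  locallyIntegrable_rhs := hu.2.sub hv.2
  weak_eq ψ hψ := by
    simp_rw [inner_sub_left, sub_mul]
    rw [integral_sub (hu.integrable_left hψ) (hv.integrable_left hψ),
      integral_sub (hu.integrable_right hψ) (hv.integrable_right hψ), hu.3 ψ hψ, hv.3 ψ hψ]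
    ring

theorem SolvesDiv.congr {f : E d → ℝ} {u v : E d → E d} (hu : SolvesDiv ρ f u)
    (h : u =ᵐ[wMeasure ρ] v) : SolvesDiv ρ f v where
  locallyIntegrable := hu.1.congr h
  locallyIntegrable_rhs := hu.2
  weak_eq ψ hψ := by
    rw [← hu.3 ψ hψ]
    refine integral_congr_ae ?_
    filter_upwards [h] with x hx
    rw [hx]

theorem normSq_eq_eLpNorm_sq (u : E d → E d) : normSq ρ u = eLpNorm u 2 (wMeasure ρ) ^ 2 :=
  (eLpNorm_two_sq u _).symm

theorem normSq_neg_smul {β : ℝ} (G : E d → E d) :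
    normSq ρ (fun x => -(β • G x)) = ENNReal.ofReal (β ^ 2) * normSq ρ G := by
  rw [normSq, normSq, ← lintegral_const_mul' _ _ (by finiteness)]
  congr 1
  ext1 x
  rw [enorm_neg, enorm_smul, mul_pow, ← ofReal_norm, ← ENNReal.ofReal_pow (norm_nonneg _),
    Real.norm_eq_abs, sq_abs]

/-- Pythagoras for the sum of a gradient and a divergence-free field. -/
theorem InH1.normSq_add_divFree [IsFiniteMeasure (wMeasure ρ)] (hρ : Continuous ρ)
    (hpos : ∀ x, 0 < ρ x) {φ : E d → ℝ} {G v : E d → E d} (h : InH1 ρ φ G) (hv : DivFree ρ v)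
    (β : ℝ) : normSq ρ (fun x => -(β • G x) + v x) =
      ENNReal.ofReal (β ^ 2) * normSq ρ G + normSq ρ v := by
  have hvm : AEStronglyMeasurable v (wMeasure ρ) := hv.locallyIntegrable.aestronglyMeasurable
  have hG : MemLp (fun x => -(β • G x)) 2 (wMeasure ρ) := (h.memLp_grad.const_smul β).neg
  by_cases hv2 : MemLp v 2 (wMeasure ρ)
  · have horth := h.integral_inner_divFree hρ hpos hv hv2
    have hsum : MemLp (fun x => -(β • G x) + v x) 2 (wMeasure ρ) := hG.add hv2
    rw [← normSq_neg_smul, normSq_eq_eLpNorm_sq, normSq_eq_eLpNorm_sq, normSq_eq_eLpNorm_sq,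
      eLpNorm_two_sq_eq_ofReal hsum, eLpNorm_two_sq_eq_ofReal hG, eLpNorm_two_sq_eq_ofReal hv2,
      ← ENNReal.ofReal_add (by positivity) (by positivity)]
    congr 1
    have iG := (memLp_two_iff_integrable_sq_norm hG.1).1 hG
    have iv := (memLp_two_iff_integrable_sq_norm hvm).1 hv2
    have ii := (integrable_inner_of_memLp h.memLp_grad hv2).const_mul (-2 * β)
    have e : (fun x => ‖-(β • G x) + v x‖ ^ 2) = fun x =>
        ‖-(β • G x)‖ ^ 2 + ‖v x‖ ^ 2 + -2 * β * inner ℝ (G x) (v x) := by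
      ext1 x
      rw [norm_add_sq_real, inner_neg_left, real_inner_smul_left]
      ring
    have iGv : Integrable (fun x => ‖-(β • G x)‖ ^ 2 + ‖v x‖ ^ 2) (wMeasure ρ) := iG.add iv
    rw [e, integral_add iGv ii, integral_add iG iv, integral_const_mul, horth]
    ring
  -- If `v` is not square integrable, neither is its sum with the square-integrable gradient part,
  -- so both sides are infinite.
  · have hvtop : normSq ρ v = ⊤ := by
      by_contra hne
      refine hv2 ⟨hvm, lt_top_iff_ne_top.2 fun ht => hne ?_⟩
      rw [normSq_eq_eLpNorm_sq, ht]
      rfl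
    rw [hvtop, add_top]
    by_contra hne
    refine hv2 ?_
    have hum : AEStronglyMeasurable (fun x => -(β • G x) + v x) (wMeasure ρ) := hG.1.add hvm
    have hu : MemLp (fun x => -(β • G x) + v x) 2 (wMeasure ρ) := by
      refine ⟨hum, lt_top_iff_ne_top.2 fun ht => hne ?_⟩
      rw [normSq_eq_eLpNorm_sq, ht]
      rfl
    have := hu.sub hG
    refine this.ae_eq (Eventually.of_forall fun x => ?_)
    simp

theorem normSq_congr {u v : E d → E d} (h : u =ᵐ[wMeasure ρ] v) : normSq ρ u = normSq ρ v := by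
  rw [normSq_eq_eLpNorm_sq, normSq_eq_eLpNorm_sq, eLpNorm_congr_ae h]

end L2Opt

/-! ### Assembly of the main result. -/

theorem lemma1 {d : ℕ} (ρ h : L2Opt.E d → ℝ) (β : ℝ) (hβ : 0 < β)
    (hA1 : L2Opt.AssumptionA1 ρ) (hA2 : L2Opt.AssumptionA2 ρ h) :
    -- the Poisson equation has a weak solution
    (∃ φ G, L2Opt.IsPoissonSolution ρ h φ G) ∧
    ∀ φ G, L2Opt.IsPoissonSolution ρ h φ G →
      -- which is unique
      (∀ φ' G', L2Opt.IsPoissonSolution ρ h φ' G' → φ' =ᵐ[volume] φ ∧ G' =ᵐ[volume] G) ∧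
      -- the general solution of the control equation
      (∀ u : L2Opt.E d → L2Opt.E d, L2Opt.SolvesControl ρ h β u ↔
        ∃ v, L2Opt.DivFree ρ v ∧ u =ᵐ[volume] fun x => -(β • G x) + v x) ∧
      -- the norm identity
      (∀ u v : L2Opt.E d → L2Opt.E d, L2Opt.DivFree ρ v →
        (u =ᵐ[volume] fun x => -(β • G x) + v x) →
        L2Opt.normSq ρ u =
          ENNReal.ofReal (β ^ 2) * L2Opt.normSq ρ G + L2Opt.normSq ρ v) ∧
      -- the gradient solution is the solution of minimum norm, and the only one
      L2Opt.SolvesControl ρ h β (fun x => -(β • G x)) ∧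
      L2Opt.normSq ρ (fun x => -(β • G x)) < ⊤ ∧
      ∀ u : L2Opt.E d → L2Opt.E d, L2Opt.SolvesControl ρ h β u →
        L2Opt.normSq ρ (fun x => -(β • G x)) ≤ L2Opt.normSq ρ u ∧
        (L2Opt.normSq ρ u = L2Opt.normSq ρ (fun x => -(β • G x)) →
          u =ᵐ[volume] fun x => -(β • G x)) := by
  open L2Opt in
  obtain ⟨K, hK, hpoinc⟩ := hA1.exists_poincare
  obtain ⟨hden, V, hρV, ⟨hV, -⟩, -⟩ := hA1
  obtain ⟨⟨hh, -⟩, hh2, -⟩ := hA2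
  have hprob := hden.isProbabilityMeasure
  have hρ : Continuous ρ := by
    rw [show ρ = fun x => Real.exp (-V x) from funext hρV]
    exact Real.continuous_exp.comp hV.continuous.neg
  have hpos : ∀ x, 0 < ρ x := fun x => by rw [hρV]; positivity
  have hac := volume_absolutelyContinuous_wMeasure hρ hpos
  have hac' := wMeasure_absolutelyContinuous ρ
  have hf : MemLp (fun x => h x - mean ρ h) 2 (wMeasure ρ) := hh2.sub (memLp_const _)
  have hf0 : ∫ x, (h x - mean ρ h) ∂(wMeasure ρ) = 0 := by
    rw [integral_sub (hh2.integrable (by norm_num)) (integrable_const _)]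
    simp [mean]
  refine ⟨?_, fun φ G hφ => ?_⟩
  · obtain ⟨φ, G, h1, h2, h3⟩ := exists_weak_solution hρ hpos hK hpoinc hf hf0
    exact ⟨φ, G, h1, h2, h3⟩
  have hsol : SolvesControl ρ h β (fun x => -(β • G x)) := by
    have hG : MemLp (fun x => -(β • G x)) 2 (wMeasure ρ) := (hφ.inH1.memLp_grad.const_smul β).neg
    refine ⟨(hG.integrable (by norm_num)).locallyIntegrable,
      ((hf.integrable (by norm_num)).const_mul β).locallyIntegrable, fun ψ hψ => ?_⟩
    simp_rw [inner_neg_left, real_inner_smul_left, mul_assoc]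
    rw [integral_neg, integral_const_mul, integral_const_mul, hφ.weak_eq _ _ hψ.inH1]
  have hgen (u : E d → E d) (hu : SolvesControl ρ h β u) :
      ∃ v, DivFree ρ v ∧ u =ᵐ[volume] fun x => -(β • G x) + v x := by
    refine ⟨fun x => u x - -(β • G x), ?_, Eventually.of_forall fun x => by simp⟩
    have := SolvesDiv.sub hu hsol
    simp only [sub_self] at this
    exact this
  have hpyth (u v : E d → E d) (hv : DivFree ρ v) (huv : u =ᵐ[volume] fun x => -(β • G x) + v x) :
      normSq ρ u = ENNReal.ofReal (β ^ 2) * normSq ρ G + normSq ρ v := by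
    rw [normSq_congr (hac'.ae_eq huv), hφ.inH1.normSq_add_divFree hρ hpos hv]
  have hfin : normSq ρ (fun x => -(β • G x)) < ⊤ := by
    rw [normSq_neg_smul, normSq_eq_eLpNorm_sq]
    exact ENNReal.mul_lt_top ENNReal.ofReal_lt_top
      (ENNReal.pow_lt_top hφ.inH1.memLp_grad.eLpNorm_lt_top)
  refine ⟨fun φ' G' hφ' => ?_, fun u => ⟨hgen u, ?_⟩, hpyth, hsol, hfin, fun u hu => ?_⟩
  -- Both weak equations are tested with `φ' - φ`: subtraction gives `∫ |G' - G|² ρ = 0`, and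
  -- Poincaré with zero mean yields `φ' = φ`.
  · have hd := hφ'.inH1.sub hφ.inH1
    have e1 := hφ'.weak_eq _ _ hd
    rw [← hφ.weak_eq _ _ hd] at e1
    have e2 : ∫ x, ‖G' x - G x‖ ^ 2 ∂(wMeasure ρ) = 0 := by
      simp_rw [← real_inner_self_eq_norm_sq]
      conv_lhs => enter [2, x]; rw [inner_sub_left]
      rw [integral_sub (integrable_inner_of_memLp hφ'.inH1.memLp_grad hd.memLp_grad)
        (integrable_inner_of_memLp hφ.inH1.memLp_grad hd.memLp_grad), e1, sub_self]
    have e3 : eLpNorm (fun x => G' x - G x) 2 (wMeasure ρ) = 0 := by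
      have := eLpNorm_two_sq_eq_ofReal hd.memLp_grad
      rw [e2, ENNReal.ofReal_zero] at this
      exact pow_eq_zero_iff two_ne_zero |>.1 this
    have e4 : mean ρ (fun x => φ' x - φ x) = 0 := by
      rw [mean, integral_sub (hφ'.inH1.memLp.integrable (by norm_num))
        (hφ.inH1.memLp.integrable (by norm_num))]
      exact sub_eq_zero.2 (hφ'.mean_zero.trans hφ.mean_zero.symm)
    have e5 := hpoinc _ _ hd
    rw [e3, e4, mul_zero, enorm_zero, add_zero, nonpos_iff_eq_zero] at e5
    rw [eLpNorm_eq_zero_iff hd.memLp.1 two_ne_zero] at e5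
    rw [eLpNorm_eq_zero_iff hd.memLp_grad.1 two_ne_zero] at e3
    refine ⟨hac.ae_eq ?_, hac.ae_eq ?_⟩
    · filter_upwards [e5] with x hx using sub_eq_zero.1 hx
    · filter_upwards [e3] with x hx using sub_eq_zero.1 hx
  · rintro ⟨v, hv, huv⟩
    have := SolvesDiv.add hsol hv
    simp only [add_zero] at this
    exact this.congr (hac'.ae_eq huv).symm
  · obtain ⟨v, hv, huv⟩ := hgen u hu
    have e := hpyth u v hv huv
    rw [← normSq_neg_smul] at e
    refine ⟨e ▸ le_self_add, fun heq => ?_⟩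
    rw [heq] at e
    -- In `ℝ≥0∞` this cancellation requires the norm of `-β∇φ` to be finite.
    have hv0 : normSq ρ v = 0 := by
      have := ENNReal.add_right_inj hfin.ne (b := normSq ρ v) (c := 0)
      rw [add_zero, ← e] at this
      exact this.1 rfl
    rw [normSq_eq_eLpNorm_sq, pow_eq_zero_iff two_ne_zero,
      eLpNorm_eq_zero_iff hv.locallyIntegrable.aestronglyMeasurable two_ne_zero] at hv0
    filter_upwards [huv, hac.ae_eq hv0] with x h1 h2
    rw [h1, h2]
    simp
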